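/- Let $\Bbbk$ be an algebraically closed field of characteristic $0$, let $U$ be an associative unital $\Bbbk$-algebra, and let $\Gamma\subset U$ be a finitely generated commutative subalgebra which is a Harish-Chandra subalgebra: for every $u\in U$ the bimodule $\Gamma u\Gamma$ is finitely generated both as a left and as a right $\Gamma$-module. Let $F(U)$ be the directed set of finitely generated $\Gamma$-subbimodules of $U$, and let $\mathcal A$ be the $\Bbbk$-linear category whose objects are the maximal ideals of $\Gamma$, with $$\mathcal A(\mathfrak m,\mathfrak n)=\varinjlim_{V\in F(U)}\ \varprojlim_{a,b}\ V/(\mathfrak n^aV+V\mathfrak m^b),$$ each $\mathcal A(\mathfrak m,\mathfrak n)$ carrying the direct limit (finest) topology of the inverse limits of the discrete spaces $V/(\mathfrak n^aV+V\mathfrak m^b)$. The composition $\mathcal A(\mathfrak p,\mathfrak n)\times\mathcal A(\mathfrak m,\mathfrak p)\to\mathcal A(\mathfrak m,\mathfrak n)$ is induced by the multiplication of $U$: for $V,W\in F(U)$, modulo $\mathfrak n^aVW+VW\mathfrak m^b$ the product of the classes of $v\in V$ and $w\in W$, taken modulo $\mathfrak n^aV+V\mathfrak p^c$ and $\mathfrak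 p^cW+W\mathfrak m^b$ with $c$ large, is the class of $v\gamma w$, where $\gamma\in\Gamma$ with $\gamma\equiv 1 \pmod{\mathfrak p^c}$ acts on the finite-dimensional right $\Gamma$-module $V/\mathfrak n^aV$ as the projection onto its $\mathfrak p$-primary component. Let $u_{\mathfrak n,\mathfrak m}$ be the image of $u\in U$ in $\mathcal A(\mathfrak m,\mathfrak n)$. For a set $D$ of maximal ideals of $\Gamma$, let $M_D\subset\prod_{(\mathfrak n,\mathfrak m)\in D\times D}\mathcal A(\mathfrak m,\mathfrak n)$ be the algebra of those $D\times D$ matrices, with entry in row $\mathfrak n$ and column $\mathfrak m$ from $\mathcal A(\mathfrak m,\mathfrak n)$, which have finitely many nonzero entries in every row and in every column; it carries the topology induced by the product topology. Write $M_{\mathcal A}$ for $M_D$ with $D$ the set of all maximal ideals, and let $\pi_D:M_{\mathcal A}\to M_D$ be the restriction to rows and columns in $D$. Let $\Delta$ be the smallest equivalence relation on the set of maximal ideals of $\Gamma$ for which $\mathfrak m$ and $\mathfrak n$ are equivalent whenever $\Gamma/\mathfrak n\otimes_\Gamma\Gamma u\Gamma\otimes_\Gamma\Gamma/\mathfrak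 m\neq 0$ for some $u\in U$. Then: 1. For every $u\in U$ the matrix $[u]$ with entry $u_{\mathfrak n,\mathfrak m}$ in row $\mathfrak n$ and column $\mathfrak m$ lies in $M_{\mathcal A}$, and $u\mapsto[u]$ is a homomorphism of $\Bbbk$-algebras $i_{\mathcal A}:U\to M_{\mathcal A}$. 2. For every equivalence class $D$ of $\Delta$ the image of $\pi_D\circ i_{\mathcal A}$ is dense in $M_D$. -/

import Mathlib

open CategoryTheory
open scoped IsMulCommutative

universe u v w

/-! ### Row- and column-finite matrices over a `k`-linear category -/

section Matrices

variable (k : Type w) [Field k] {C : Type u} [Category.{v} C] [Preadditive C] [Linear k C]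

/-- For a family `X : I → C` of objects of a `k`-linear category: the space `M_I` of all
`I × I` matrices `F` whose entry in row `i` and column `j` is a morphism `X j ⟶ X i`, with finitely
many nonzero entries in every row and in every column. -/
def RCFMatrix {I : Type*} (X : I → C) : Submodule k (∀ i j : I, X j ⟶ X i) where
  carrier := {F | (∀ i, {j | F i j ≠ 0}.Finite) ∧ ∀ j, {i | F i j ≠ 0}.Finite}
  add_mem' := by
    rintro F G ⟨hF, hF'⟩ ⟨hG, hG'⟩
    refine ⟨fun i => ((hF i).union (hG i)).subset ?_, fun j => ((hF' j).union (hG' j)).subset ?_⟩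
    · intro j hj
      by_contra h
      simp only [Set.mem_union, Set.mem_ofPred_eq, not_or, not_not] at h
      exact hj (by simp [h.1, h.2])
    · intro i hi
      by_contra h
      simp only [Set.mem_union, Set.mem_ofPred_eq, not_or, not_not] at h
      exact hi (by simp [h.1, h.2])
  zero_mem' := by simp
  smul_mem' := by
    rintro c F ⟨hF, hF'⟩
    refine ⟨fun i => (hF i).subset ?_, fun j => (hF' j).subset ?_⟩
    · intro j hj h
      exact hj (by simp [h])
    · intro i hi h
      exact hi (by simp [h])

namespace RCFMatrix

variable {k} {I : Type*} {X : I → C}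

theorem ext' {F G : RCFMatrix k X} (h : ∀ i j, F.1 i j = G.1 i j) : F = G :=
  Subtype.ext (funext fun i => funext fun j => h i j)

/-- The (row `i`) by (column `j`) product: the sum over `l` of the composites
`X j ⟶ X l ⟶ X i` of `G l j` and `F i l`; only finitely many of them are nonzero. -/
noncomputable def mulEntry (F G : RCFMatrix k X) (i j : I) : X j ⟶ X i :=
  ∑ l ∈ (F.2.1 i).toFinset, G.1 l j ≫ F.1 i l

theorem mulEntry_eq_sum (F G : RCFMatrix k X) (i j : I) (s : Finset I)
    (hs : ∀ l, F.1 i l ≠ 0 → l ∈ s) : mulEntry F G i j = ∑ l ∈ s, G.1 l j ≫ F.1 i l := by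
  refine Finset.sum_subset (fun l hl => hs l (by simpa using hl)) fun l _ hl => ?_
  have : F.1 i l = 0 := by simpa using hl
  simp [this]

noncomputable instance : Mul (RCFMatrix k X) where
  mul F G := ⟨mulEntry F G, by
    classical
    constructor
    · intro i
      refine ((F.2.1 i).toFinset.biUnion fun l => (G.2.1 l).toFinset).finite_toSet.subset ?_
      intro j hj
      obtain ⟨l, hl, h⟩ := Finset.exists_ne_zero_of_sum_ne_zero hj
      simp only [Finset.coe_biUnion, Set.mem_iUnion]
      refine ⟨l, hl, ?_⟩
      simp only [Set.Finite.coe_toFinset, Set.mem_ofPred_eq]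
      intro h0
      exact h (by simp [h0])
    · intro j
      refine ((G.2.2 j).toFinset.biUnion fun l => (F.2.2 l).toFinset).finite_toSet.subset ?_
      intro i hi
      obtain ⟨l, hl, h⟩ := Finset.exists_ne_zero_of_sum_ne_zero hi
      simp only [Finset.coe_biUnion, Set.mem_iUnion]
      refine ⟨l, ?_, ?_⟩
      · simp only [Set.Finite.coe_toFinset, Set.mem_ofPred_eq]
        intro h0
        exact h (by simp [h0])
      · simp only [Set.Finite.coe_toFinset, Set.mem_ofPred_eq]
        intro h0
        exact h (by simp [h0])⟩

theorem mul_apply (F G : RCFMatrix k X) (i j : I) : (F * G).1 i j = mulEntry F G i j := rfl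

open Classical in
/-- The matrix with identity morphisms on the diagonal and zeros elsewhere. -/
noncomputable instance : One (RCFMatrix k X) where
  one := ⟨fun i j => if h : j = i then eqToHom (by rw [h]) else 0, by
    constructor
    · intro i
      refine (Set.finite_singleton i).subset fun j hj => ?_
      by_contra h
      exact hj (dif_neg h)
    · intro i
      refine (Set.finite_singleton i).subset fun j hj => ?_
      by_contra h
      exact hj (dif_neg fun h' => h h'.symm)⟩

theorem one_apply_same (i : I) : (1 : RCFMatrix k X).1 i i = 𝟙 (X i) := by
  exact (dif_pos rfl).trans (by simp)

theorem add_apply (F G : RCFMatrix k X) (i j : I) : (F + G).1 i j = F.1 i j + G.1 i j := rfl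

theorem smul_apply (c : k) (F : RCFMatrix k X) (i j : I) : (c • F).1 i j = c • F.1 i j := rfl

theorem one_apply_ne {i j : I} (h : j ≠ i) : (1 : RCFMatrix k X).1 i j = 0 := dif_neg h

theorem mul_assoc' (F G H : RCFMatrix k X) : F * G * H = F * (G * H) := by
  classical
  refine ext' fun i j => ?_
  set s := (F.2.1 i).toFinset
  set t := s.biUnion fun l => (G.2.1 l).toFinset
  have hs : ∀ l, F.1 i l ≠ 0 → l ∈ s := fun l hl => by simpa [s] using hl
  have ht : ∀ l ∈ s, ∀ p, G.1 l p ≠ 0 → p ∈ t := fun l hl p hp =>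
    Finset.mem_biUnion.2 ⟨l, hl, by simpa using hp⟩
  have h1 : ∀ p, (F * G).1 i p ≠ 0 → p ∈ t := fun p hp => by
    obtain ⟨l, hl, h⟩ := Finset.exists_ne_zero_of_sum_ne_zero hp
    exact ht l hl p fun h0 => h (by simp [h0])
  rw [mul_apply, mul_apply, mulEntry_eq_sum _ _ _ _ t h1, mulEntry_eq_sum _ _ _ _ s hs]
  have h2 : ∀ l ∈ s, (G * H).1 l j ≫ F.1 i l = ∑ p ∈ t, H.1 p j ≫ G.1 l p ≫ F.1 i l :=
    fun l hl => by
      rw [mul_apply, mulEntry_eq_sum _ _ _ _ t (ht l hl), Preadditive.sum_comp]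
      simp
  have h3 : ∀ p ∈ t, H.1 p j ≫ (F * G).1 i p = ∑ l ∈ s, H.1 p j ≫ G.1 l p ≫ F.1 i l :=
    fun p _ => by
      rw [mul_apply, mulEntry_eq_sum _ _ _ _ s hs, Preadditive.comp_sum]
  rw [Finset.sum_congr rfl h2, Finset.sum_congr rfl h3, Finset.sum_comm]

noncomputable instance : Ring (RCFMatrix k X) :=
  { (inferInstance : AddCommGroup (RCFMatrix k X)),
    (inferInstance : Mul (RCFMatrix k X)), (inferInstance : One (RCFMatrix k X)) with
    mul_assoc := mul_assoc'
    one_mul := fun F => ext' fun i j => by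
      classical
      rw [mul_apply, mulEntry_eq_sum (1 : RCFMatrix k X) F i j {i} fun l hl => ?_]
      · rw [Finset.sum_singleton, one_apply_same, Category.comp_id]
      · by_contra h
        exact hl (one_apply_ne (by simpa using h))
    mul_one := fun F => ext' fun i j => by
      classical
      rw [mul_apply, mulEntry_eq_sum _ _ _ _ (insert j (F.2.1 i).toFinset) fun l hl => by
        simp [hl], Finset.sum_eq_single_of_mem j (by simp), one_apply_same, Category.id_comp]
      intro l _ hl
      rw [one_apply_ne hl.symm, Limits.zero_comp]
    left_distrib := fun F G H => ext' fun i j => by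
      rw [add_apply, mul_apply, mul_apply, mul_apply]
      simp only [mulEntry, ← Finset.sum_add_distrib, ← Preadditive.add_comp]
      rfl
    right_distrib := fun F G H => ext' fun i j => by
      classical
      rw [add_apply, mul_apply, mul_apply, mul_apply]
      set s := (F.2.1 i).toFinset ∪ (G.2.1 i).toFinset
      rw [mulEntry_eq_sum F _ _ _ s fun l hl => by simp [s, hl],
        mulEntry_eq_sum G _ _ _ s fun l hl => by simp [s, hl],
        mulEntry_eq_sum (F + G) _ _ _ s fun l hl => ?_]
      · simp only [← Finset.sum_add_distrib, ← Preadditive.comp_add]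
        rfl
      · by_contra h
        simp only [s, Finset.mem_union, Set.Finite.mem_toFinset, Set.mem_ofPred_eq, not_or,
          not_not] at h
        apply hl
        change F.1 i l + G.1 i l = 0
        rw [h.1, h.2, add_zero]
    zero_mul := fun F => ext' fun i j => by
      rw [mul_apply, mulEntry_eq_sum (0 : RCFMatrix k X) F i j ∅ fun l hl => (hl rfl).elim]
      rfl
    mul_zero := fun F => ext' fun i j => Finset.sum_eq_zero fun l _ => by
      change (0 : X j ⟶ X l) ≫ _ = _
      simp }

noncomputable instance : Algebra k (RCFMatrix k X) :=
  Algebra.ofModule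
    (fun c F G => ext' fun i j => by
      classical
      rw [smul_apply, mul_apply, mul_apply]
      rw [mulEntry_eq_sum (c • F) _ _ _ (F.2.1 i).toFinset fun l hl => ?_]
      · simp only [mulEntry, Finset.smul_sum]
        exact Finset.sum_congr rfl fun l _ => Linear.comp_smul _ _ _ _ _ _
      · simp only [Set.Finite.mem_toFinset, Set.mem_ofPred_eq]
        intro h
        apply hl
        change c • F.1 i l = 0
        rw [h, smul_zero])
    (fun c F G => ext' fun i j => by
      rw [smul_apply, mul_apply, mul_apply]
      simp only [mulEntry, Finset.smul_sum]
      exact Finset.sum_congr rfl fun l _ => Linear.smul_comp _ _ _ _ _ _)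

/-- The block of a matrix with rows and columns in `D ⊆ I`. -/
def block (D : Set I) : RCFMatrix k X →ₗ[k] RCFMatrix k (fun d : D => X d) where
  toFun F := ⟨fun i j => F.1 i j,
    fun i => (F.2.1 i).preimage Subtype.val_injective.injOn,
    fun j => (F.2.2 j).preimage Subtype.val_injective.injOn⟩
  map_add' _ _ := rfl
  map_smul' _ _ := rfl

end RCFMatrix

end Matrices

/-! ### Harish-Chandra subalgebras and finitary completions -/

section GelfandTsetlin

variable {k : Type w} {U : Type u} [Field k] [Ring U] [Algebra k U]

/-- A commutative subalgebra `Γ` of `U` is a Harish-Chandra subalgebra if for every `u ∈ U` the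
bimodule `Γ u Γ` is finitely generated both as a left and as a right `Γ`-module.
(Products are products of `k`-subspaces of `U`.) -/
class IsHarishChandra (Γ : Subalgebra k U) : Prop where
  left_fg : ∀ u : U, ∃ S : Finset U,
    Γ.toSubmodule * Submodule.span k {u} * Γ.toSubmodule = Γ.toSubmodule * Submodule.span k S
  right_fg : ∀ u : U, ∃ S : Finset U,
    Γ.toSubmodule * Submodule.span k {u} * Γ.toSubmodule = Submodule.span k S * Γ.toSubmodule

variable (Γ : Subalgebra k U)

/-- `F(U)`: the finitely generated `Γ`-subbimodules `V = Γ S Γ` (`S` finite) of `U`, ordered by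
inclusion. -/
abbrev FGBimod : Type u :=
  {V : Submodule k U // ∃ S : Finset U, V = Γ.toSubmodule * Submodule.span k S * Γ.toSubmodule}

noncomputable instance : DecidableEq (FGBimod Γ) := Classical.decEq _

/-- The bimodule `Γ u Γ`. -/
def FGBimod.gen (u : U) : FGBimod Γ :=
  ⟨Γ.toSubmodule * Submodule.span k {u} * Γ.toSubmodule, {u}, by simp⟩

variable {Γ}

theorem FGBimod.left_mem (V : FGBimod Γ) {g v : U} (hg : g ∈ Γ) (hv : v ∈ V.1) : g * v ∈ V.1 := by
  obtain ⟨V, S, rfl⟩ := V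
  have h : g * v ∈ Γ.toSubmodule * (Γ.toSubmodule * Submodule.span k S * Γ.toSubmodule) :=
    Submodule.mul_mem_mul hg hv
  rwa [← mul_assoc, ← mul_assoc, (Subalgebra.isIdempotentElem_toSubmodule Γ).eq] at h

theorem FGBimod.right_mem (V : FGBimod Γ) {g v : U} (hv : v ∈ V.1) (hg : g ∈ Γ) :
    v * g ∈ V.1 := by
  obtain ⟨V, S, rfl⟩ := V
  have h : v * g ∈ (Γ.toSubmodule * Submodule.span k S * Γ.toSubmodule) * Γ.toSubmodule :=
    Submodule.mul_mem_mul hv hg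
  rwa [mul_assoc _ Γ.toSubmodule, (Subalgebra.isIdempotentElem_toSubmodule Γ).eq] at h

theorem FGBimod.mem_gen (u : U) : u ∈ (FGBimod.gen Γ u).1 := by
  have h : 1 * u * 1 ∈ Γ.toSubmodule * Submodule.span k {u} * Γ.toSubmodule :=
    Submodule.mul_mem_mul (Submodule.mul_mem_mul Γ.one_mem (Submodule.mem_span_singleton_self u))
      Γ.one_mem
  rw [one_mul, mul_one] at h
  exact h

theorem FGBimod.exists_left_fg [IsHarishChandra Γ] (V : FGBimod Γ) :
    ∃ S : Finset U, V.1 = Γ.toSubmodule * Submodule.span k S := by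
  classical
  obtain ⟨V, S, rfl⟩ := V
  induction S using Finset.induction with
  | empty => exact ⟨∅, by simp⟩
  | insert u S _ ih =>
    obtain ⟨T, hT⟩ := ih
    obtain ⟨T', hT'⟩ := IsHarishChandra.left_fg (Γ := Γ) u
    refine ⟨T' ∪ T, ?_⟩
    simp only at hT ⊢
    rw [Finset.coe_insert, Submodule.span_insert, Submodule.mul_sup, Submodule.sup_mul, hT, hT',
      Finset.coe_union, Submodule.span_union, Submodule.mul_sup]

/-- The product `VW`: the span of all `v w` with `v ∈ V`, `w ∈ W`. -/
def FGBimod.mul [IsHarishChandra Γ] (V W : FGBimod Γ) : FGBimod Γ :=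
  ⟨V.1 * W.1, by
    classical
    obtain ⟨S, hS⟩ := V.exists_left_fg
    obtain ⟨W, T, rfl⟩ := W
    refine ⟨Finset.image₂ (· * ·) S T, ?_⟩
    have hV : V.1 * Γ.toSubmodule = V.1 := by
      obtain ⟨V, S, rfl⟩ := V
      simp only [mul_assoc, (Subalgebra.isIdempotentElem_toSubmodule Γ).eq]
    simp only
    rw [← mul_assoc, ← mul_assoc, hV, hS, mul_assoc Γ.toSubmodule, Submodule.span_mul_span,
      Finset.coe_image₂, Set.image2_mul]⟩

theorem FGBimod.mul_mono [IsHarishChandra Γ] {V V' W W' : FGBimod Γ} (hV : V ≤ V') (hW : W ≤ W') :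
    V.mul W ≤ V'.mul W' :=
  mul_le_mul' (show V.1 ≤ V'.1 from hV) hW

noncomputable instance : Nonempty (FGBimod Γ) := ⟨FGBimod.gen Γ 1⟩

instance : IsDirectedOrder (FGBimod Γ) where
  directed := by
    classical
    rintro ⟨V, S, rfl⟩ ⟨W, T, rfl⟩
    refine ⟨⟨_, S ∪ T, rfl⟩, ?_, ?_⟩
    · exact mul_le_mul' (mul_le_mul' le_rfl (Submodule.span_mono (by simp))) le_rfl
    · exact mul_le_mul' (mul_le_mul' le_rfl (Submodule.span_mono (by simp))) le_rfl

/-- An ideal of `Γ` as a `k`-subspace of `U`. -/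
def idealSub (I : Ideal Γ) : Submodule k U := (I.restrictScalars k).map Γ.val.toLinearMap

theorem idealSub_mono {I J : Ideal Γ} (h : I ≤ J) : idealSub I ≤ idealSub J :=
  Submodule.map_mono h

theorem mem_idealSub {I : Ideal Γ} {x : Γ} (hx : x ∈ I) : (x : U) ∈ idealSub I :=
  ⟨x, hx, rfl⟩

theorem idealSub_mul_right (V : FGBimod Γ) (I : Ideal Γ) {y : U} (hy : y ∈ idealSub I * V.1)
    (g : Γ) : y * g ∈ idealSub I * V.1 := by
  induction hy using Submodule.mul_induction_on' with
  | mem_mul_mem i hi v hv =>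
    rw [mul_assoc]
    exact Submodule.mul_mem_mul hi (V.right_mem hv g.2)
  | add x _ y _ hx hy =>
    rw [add_mul]
    exact add_mem hx hy

theorem mul_cut_mem {V W T : FGBimod Γ} (hT : V.1 * W.1 ≤ T.1) {v w : U} (hv : v ∈ V.1) (γ : Γ) (hw : w ∈ W.1) :
    v * γ * w ∈ T.1 :=
  hT (Submodule.mul_mem_mul (V.right_mem hv γ.2) hw)

variable [IsMulCommutative Γ]

/-- The sub-bimodule `𝔫ᵃ V + V 𝔪ᵇ`. -/
def filt (n m : Ideal Γ) (V : FGBimod Γ) (a b : ℕ) : Submodule k U :=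
  idealSub (n ^ a) * V.1 ⊔ V.1 * idealSub (m ^ b)

/-- `V / (𝔫ᵃ V + V 𝔪ᵇ)`. -/
def filtQuot (n m : Ideal Γ) (V : FGBimod Γ) (a b : ℕ) : Type u :=
  V.1 ⧸ (filt n m V a b).submoduleOf V.1

instance (n m : Ideal Γ) (V : FGBimod Γ) (a b : ℕ) : AddCommGroup (filtQuot n m V a b) :=
  Submodule.Quotient.addCommGroup ((filt n m V a b).submoduleOf V.1)

instance (n m : Ideal Γ) (V : FGBimod Γ) (a b : ℕ) : Module k (filtQuot n m V a b) :=
  Submodule.Quotient.module ((filt n m V a b).submoduleOf V.1)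

/-- The quotient map `V ⟶ V / (𝔫ᵃ V + V 𝔪ᵇ)`. -/
def filtMk (n m : Ideal Γ) (V : FGBimod Γ) (a b : ℕ) : V.1 →ₗ[k] filtQuot n m V a b :=
  ((filt n m V a b).submoduleOf V.1).mkQ

theorem filtMk_surjective (n m : Ideal Γ) (V : FGBimod Γ) (a b : ℕ) :
    Function.Surjective (filtMk n m V a b) :=
  Submodule.mkQ_surjective _

theorem filtMk_eq_iff (n m : Ideal Γ) (V : FGBimod Γ) (a b : ℕ) (v v' : V.1) :
    filtMk n m V a b v = filtMk n m V a b v' ↔ (v : U) - v' ∈ filt n m V a b :=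
  Submodule.Quotient.eq ((filt n m V a b).submoduleOf V.1)

theorem filt_anti (n m : Ideal Γ) (V : FGBimod Γ) {a a' b b' : ℕ} (ha : a ≤ a') (hb : b ≤ b') :
    filt n m V a' b' ≤ filt n m V a b :=
  sup_le_sup (mul_le_mul' (idealSub_mono (Ideal.pow_le_pow_right ha)) le_rfl)
    (mul_le_mul' le_rfl (idealSub_mono (Ideal.pow_le_pow_right hb)))

theorem filt_mono (n m : Ideal Γ) {V W : FGBimod Γ} (h : V ≤ W) (a b : ℕ) :
    filt n m V a b ≤ filt n m W a b :=
  sup_le_sup (mul_le_mul' le_rfl h) (mul_le_mul' h le_rfl)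

/-- The projection from `V / (𝔫ᵃ' V + V 𝔪ᵇ')` to `V / (𝔫ᵃ V + V 𝔪ᵇ)` for `a ≤ a'`, `b ≤ b'`. -/
def filtProj (n m : Ideal Γ) (V : FGBimod Γ) {a a' b b' : ℕ} (ha : a ≤ a') (hb : b ≤ b') :
    filtQuot n m V a' b' →ₗ[k] filtQuot n m V a b :=
  Submodule.mapQ ((filt n m V a' b').submoduleOf V.1) ((filt n m V a b).submoduleOf V.1)
    LinearMap.id fun _ hx => filt_anti n m V ha hb hx

/-- The map `V / (𝔫ᵃ V + V 𝔪ᵇ) ⟶ W / (𝔫ᵃ W + W 𝔪ᵇ)` induced by an inclusion `V ⊆ W`. -/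
def filtIncl (n m : Ideal Γ) {V W : FGBimod Γ} (h : V ≤ W) (a b : ℕ) :
    filtQuot n m V a b →ₗ[k] filtQuot n m W a b :=
  Submodule.mapQ ((filt n m V a b).submoduleOf V.1) ((filt n m W a b).submoduleOf W.1)
    (Submodule.inclusion h) fun _ hy => filt_mono n m h a b hy

/-- The completion `lim_{a,b} V / (𝔫ᵃ V + V 𝔪ᵇ)`. -/
def Completion (n m : Ideal Γ) (V : FGBimod Γ) :
    Submodule k (∀ a b : ℕ, filtQuot n m V a b) where
  carrier := {x | ∀ (a a' b b' : ℕ) (ha : a ≤ a') (hb : b ≤ b'),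
    filtProj n m V ha hb (x a' b') = x a b}
  add_mem' hx hy a a' b b' ha hb := by
    rw [Pi.add_apply, Pi.add_apply, Pi.add_apply, Pi.add_apply, map_add, hx a a' b b' ha hb,
      hy a a' b b' ha hb]
  zero_mem' a a' b b' ha hb := map_zero _
  smul_mem' c x hx a a' b b' ha hb := by
    rw [Pi.smul_apply, Pi.smul_apply, Pi.smul_apply, Pi.smul_apply, map_smul, hx a a' b b' ha hb]

/-- The inverse limit topology of the discrete spaces `V / (𝔫ᵃ V + V 𝔪ᵇ)`. -/
instance (n m : Ideal Γ) (V : FGBimod Γ) : TopologicalSpace (Completion n m V) :=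
  ⨅ (a : ℕ) (b : ℕ), TopologicalSpace.induced (fun x => x.1 a b) ⊥

/-- The element of the completion given by an element `v ∈ V`. -/
def Completion.const (n m : Ideal Γ) {V : FGBimod Γ} (v : U) (hv : v ∈ V.1) : Completion n m V :=
  ⟨fun a b => filtMk n m V a b ⟨v, hv⟩, fun _ _ _ _ _ _ => rfl⟩

/-- The map of completions induced by an inclusion `V ⊆ W`. -/
def Completion.trans (n m : Ideal Γ) (V W : FGBimod Γ) (h : V ≤ W) :
    Completion n m V →ₗ[k] Completion n m W where
  toFun x := ⟨fun a b => filtIncl n m h a b (x.1 a b), by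
    intro a a' b b' ha hb
    beta_reduce
    rw [← x.2 a a' b b' ha hb]
    obtain ⟨y, hy⟩ := filtMk_surjective n m V a' b' (x.1 a' b')
    rw [← hy]
    rfl⟩
  map_add' x y := by ext; simp
  map_smul' c x := by ext; simp

/-- The finitary completion of `U` at `(𝔫, 𝔪)`: the direct limit over `V ∈ F(U)` of
`lim_{a,b} V / (𝔫ᵃ V + V 𝔪ᵇ)`. -/
def FinitaryCompletion (n m : Ideal Γ) : Type u :=
  Module.DirectLimit (fun V : FGBimod Γ => Completion n m V) (Completion.trans n m)

namespace FinitaryCompletion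

noncomputable instance (n m : Ideal Γ) : AddCommGroup (FinitaryCompletion n m) :=
  Module.DirectLimit.addCommGroup (fun V : FGBimod Γ => Completion n m V) (Completion.trans n m)

noncomputable instance (n m : Ideal Γ) : Module k (FinitaryCompletion n m) :=
  Module.DirectLimit.module (G := fun V : FGBimod Γ => Completion n m V)
    (f := Completion.trans n m)

/-- The canonical map from the completion of `V` to the finitary completion. -/
noncomputable def of (n m : Ideal Γ) (V : FGBimod Γ) :
    Completion n m V →ₗ[k] FinitaryCompletion n m :=
  Module.DirectLimit.of k (FGBimod Γ) (fun V => Completion n m V) (Completion.trans n m) V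

theorem of_trans (n m : Ideal Γ) {V W : FGBimod Γ} (h : V ≤ W) (x : Completion n m V) :
    of n m W (Completion.trans n m V W h x) = of n m V x :=
  Module.DirectLimit.of_f (f := Completion.trans n m)

theorem exists_of {n m : Ideal Γ} (x : FinitaryCompletion n m) : ∃ V y, of n m V y = x :=
  Module.DirectLimit.exists_of (f := Completion.trans n m) x

/-- The universal property of the direct limit. -/
noncomputable def lift {n m : Ideal Γ} {P : Type*} [AddCommGroup P] [Module k P]
    (g : ∀ V : FGBimod Γ, Completion n m V →ₗ[k] P)
    (hg : ∀ V W h x, g W (Completion.trans n m V W h x) = g V x) :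
    FinitaryCompletion n m →ₗ[k] P :=
  Module.DirectLimit.lift k (FGBimod Γ) (fun V => Completion n m V) (Completion.trans n m) g hg

theorem lift_of {n m : Ideal Γ} {P : Type*} [AddCommGroup P] [Module k P]
    (g : ∀ V : FGBimod Γ, Completion n m V →ₗ[k] P)
    (hg : ∀ V W h x, g W (Completion.trans n m V W h x) = g V x) (V : FGBimod Γ)
    (x : Completion n m V) : lift g hg (of n m V x) = g V x :=
  Module.DirectLimit.lift_of (f := Completion.trans n m) g hg x

/-- The direct limit topology. -/
noncomputable instance (n m : Ideal Γ) : TopologicalSpace (FinitaryCompletion n m) :=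
  ⨆ V : FGBimod Γ, TopologicalSpace.coinduced (of n m V) inferInstance

/-- The image of `u ∈ U` in the finitary completion, through `u ∈ Γ u Γ`. -/
noncomputable def image (n m : Ideal Γ) (u : U) : FinitaryCompletion n m :=
  of n m (FGBimod.gen Γ u) (Completion.const n m u (FGBimod.mem_gen u))

end FinitaryCompletion

/-! ### Composition of morphisms -/

namespace Completion

variable {n m p q : Ideal Γ} {V W T : FGBimod Γ}

/-- `v` represents the component of `x` in `V / (𝔫ᵃ V + V 𝔪ᵇ)`. -/
def Rep (x : Completion n m V) (a b : ℕ) (v : U) : Prop :=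
  ∃ hv : v ∈ V.1, filtMk n m V a b ⟨v, hv⟩ = x.1 a b

theorem exists_rep (x : Completion n m V) (a b : ℕ) : ∃ v, Rep x a b v := by
  obtain ⟨⟨v, hv⟩, h⟩ := filtMk_surjective n m V a b (x.1 a b)
  exact ⟨v, hv, h⟩

theorem Rep.mono {x : Completion n m V} {a a' b b' : ℕ} {v : U} (h : Rep x a' b' v)
    (ha : a ≤ a') (hb : b ≤ b') : Rep x a b v := by
  obtain ⟨hv, h⟩ := h
  refine ⟨hv, ?_⟩
  rw [← x.2 a a' b b' ha hb, ← h]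
  rfl

theorem Rep.sub_mem {x : Completion n m V} {a b : ℕ} {v v' : U} (h : Rep x a b v)
    (h' : Rep x a b v') : v - v' ∈ filt n m V a b := by
  obtain ⟨hv, h⟩ := h
  obtain ⟨hv', h'⟩ := h'
  exact (filtMk_eq_iff n m V a b _ _).1 (h.trans h'.symm)

theorem Rep.of_sub_mem {x : Completion n m V} {a b : ℕ} {v v' : U} (h : Rep x a b v)
    (hv' : v' ∈ V.1) (h' : v - v' ∈ filt n m V a b) : Rep x a b v' := by
  obtain ⟨hv, h⟩ := h
  refine ⟨hv', ?_⟩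
  rw [← h]
  exact ((filtMk_eq_iff n m V a b _ _).2 h').symm

theorem ext_rep {x y : Completion n m V} (h : ∀ a b, ∃ v, Rep x a b v ∧ Rep y a b v) : x = y := by
  refine Subtype.ext (funext fun a => funext fun b => ?_)
  obtain ⟨v, ⟨hv, h1⟩, ⟨_, h2⟩⟩ := h a b
  exact h1.symm.trans h2

theorem Rep.add {x y : Completion n m V} {a b : ℕ} {v v' : U} (h : Rep x a b v)
    (h' : Rep y a b v') : Rep (x + y) a b (v + v') := by
  obtain ⟨hv, h⟩ := h
  obtain ⟨hv', h'⟩ := h'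
  refine ⟨add_mem hv hv', ?_⟩
  change _ = x.1 a b + y.1 a b
  rw [← h, ← h']
  rfl

theorem Rep.smul {x : Completion n m V} {a b : ℕ} {v : U} (c : k) (h : Rep x a b v) :
    Rep (c • x) a b (c • v) := by
  obtain ⟨hv, h⟩ := h
  refine ⟨Submodule.smul_mem _ c hv, ?_⟩
  change _ = c • x.1 a b
  rw [← h]
  rfl

theorem Rep.trans {x : Completion n m V} {a b : ℕ} {v : U} (h : Rep x a b v) (hVW : V ≤ W) :
    Rep (Completion.trans n m V W hVW x) a b v := by
  obtain ⟨hv, h⟩ := h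
  refine ⟨hVW hv, ?_⟩
  change _ = filtIncl n m hVW a b (x.1 a b)
  rw [← h]
  rfl

/-- `γ ∈ Γ` acts on the finite dimensional right `Γ`-module `V / 𝔫ᵃ V` as the projection onto its
`𝔭`-primary component: `γ ≡ 1` modulo `𝔭ᶜ` and `V γ 𝔭ᶜ ⊆ 𝔫ᵃ V`. -/
structure IsCut (n p : Ideal Γ) (V : FGBimod Γ) (a c : ℕ) (γ : Γ) : Prop where
  pos : 1 ≤ c
  one_sub : 1 - γ ∈ p ^ c
  mem : ∀ v ∈ V.1, ∀ x ∈ p ^ c, v * γ * x ∈ idealSub (n ^ a) * V.1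

theorem IsCut.mono {a a' c : ℕ} {γ : Γ} (h : IsCut n p V a' c γ) (ha : a ≤ a') :
    IsCut n p V a c γ :=
  ⟨h.pos, h.one_sub, fun v hv x hx =>
    mul_le_mul' (idealSub_mono (Ideal.pow_le_pow_right ha)) le_rfl (h.mem v hv x hx)⟩

theorem finite_quotient_pow [Algebra.FiniteType k Γ] (n : Ideal Γ) [n.IsMaximal] (a : ℕ) :
    Module.Finite k (Γ ⧸ n ^ a) := by
  rw [Module.finite_iff_krullDimLE_zero, Ring.krullDimLE_zero_iff]
  intro P hP
  have hP' : (P.comap (Ideal.Quotient.mk (n ^ a))).IsPrime := Ideal.comap_isPrime _ P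
  have hle : n ≤ P.comap (Ideal.Quotient.mk (n ^ a)) := by
    refine hP'.le_of_pow_le (n := a) fun x hx => ?_
    rw [Ideal.mem_comap, Ideal.Quotient.eq_zero_iff_mem.2 hx]
    exact P.zero_mem
  have heq := Ideal.IsMaximal.eq_of_le ‹_› hP'.ne_top hle
  have : (P.comap (Ideal.Quotient.mk (n ^ a))).IsMaximal := heq ▸ ‹n.IsMaximal›
  have h := Ideal.map_eq_top_or_isMaximal_of_surjective (Ideal.Quotient.mk (n ^ a))
    Ideal.Quotient.mk_surjective this
  rw [Ideal.map_comap_of_surjective _ Ideal.Quotient.mk_surjective] at h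
  exact h.resolve_left hP.ne_top

theorem exists_fg_sup_eq_top [Algebra.FiniteType k Γ] (n : Ideal Γ) [n.IsMaximal] (a : ℕ) :
    ∃ C : Submodule k U, C.FG ∧ Γ.toSubmodule ≤ idealSub (n ^ a) ⊔ C := by
  classical
  obtain ⟨t, ht⟩ := (finite_quotient_pow (k := k) n a).fg_top
  choose f hf using fun x : Γ ⧸ n ^ a => Ideal.Quotient.mk_surjective x
  refine ⟨Submodule.span k ((fun x => (f x : U)) '' (t : Set (Γ ⧸ n ^ a))),
    Submodule.fg_span (t.finite_toSet.image _), ?_⟩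
  intro g hg
  have key : ∀ y ∈ Submodule.span k (t : Set (Γ ⧸ n ^ a)), ∀ g : Γ,
      Ideal.Quotient.mk (n ^ a) g = y → (g : U) ∈ idealSub (n ^ a) ⊔
        Submodule.span k ((fun x => (f x : U)) '' (t : Set (Γ ⧸ n ^ a))) := by
    have hz : ∀ g g' : Γ, Ideal.Quotient.mk (n ^ a) g = Ideal.Quotient.mk (n ^ a) g' →
        ((g : U) - g') ∈ idealSub (k := k) (n ^ a) := fun g g' h => by
      have := mem_idealSub (k := k) (Ideal.Quotient.eq.1 h)
      simpa using this
    intro y hy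
    induction hy using Submodule.span_induction with
    | mem x hx =>
      intro g hg
      rw [← sub_add_cancel (g : U) (f x)]
      exact Submodule.add_mem_sup (hz g (f x) (hg.trans (hf x).symm))
        (Submodule.subset_span ⟨x, hx, rfl⟩)
    | zero =>
      intro g hg
      refine Submodule.mem_sup_left ?_
      simpa using hz g 0 (by simpa using hg)
    | add x y _ _ hx hy =>
      intro g hg
      have h1 := hx (f x) (hf x)
      have h2 := hy (f y) (hf y)
      have h3 := hz g (f x + f y) (by rw [hg, map_add, hf, hf])
      rw [← sub_add_cancel (g : U) ((f x + f y : Γ) : U)]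
      exact add_mem (Submodule.mem_sup_left h3) (by simpa using add_mem h1 h2)
    | smul c x _ hx =>
      intro g hg
      have h1 := hx (f x) (hf x)
      have h3 := hz g (c • f x) (by
        rw [hg, ← Ideal.Quotient.mkₐ_eq_mk k, map_smul, Ideal.Quotient.mkₐ_eq_mk, hf])
      rw [← sub_add_cancel (g : U) ((c • f x : Γ) : U)]
      exact add_mem (Submodule.mem_sup_left h3) (by simpa using Submodule.smul_mem _ c h1)
  exact key _ (by rw [ht]; trivial) ⟨g, hg⟩ rfl

theorem exists_isCut [Algebra.FiniteType k Γ] [IsHarishChandra Γ] (n p : Ideal Γ) [n.IsMaximal]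
    (V : FGBimod Γ) (a : ℕ) : ∃ c γ, IsCut n p V a c γ := by
  classical
  obtain ⟨S, hS⟩ := V.exists_left_fg
  obtain ⟨C, hC, hGC⟩ := exists_fg_sup_eq_top (k := k) n a
  set N : Submodule k U := idealSub (n ^ a) * V.1
  have hSV : ∀ s ∈ S, s ∈ V.1 := fun s hs => by
    rw [hS, ← one_mul s]
    exact Submodule.mul_mem_mul Γ.one_mem (Submodule.subset_span hs)
  -- `V / N` is finite dimensional
  set Q : Submodule k (U ⧸ N) := V.1.map N.mkQ
  have hQ : Q.FG := by
    have h1 : V.1 ≤ N ⊔ C * Submodule.span k S := by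
      conv_lhs => rw [hS]
      refine (mul_le_mul' hGC le_rfl).trans ?_
      rw [Submodule.sup_mul]
      exact sup_le_sup (mul_le_mul' le_rfl (Submodule.span_le.2 hSV)) le_rfl
    have h2 : Q ≤ (C * Submodule.span k S).map N.mkQ := by
      refine (Submodule.map_mono h1).trans ?_
      rw [Submodule.map_sup, Submodule.mkQ_map_self, bot_sup_eq]
    have h3 : (C * Submodule.span k (S : Set U)).FG :=
      hC.mul (Submodule.fg_span S.finite_toSet)
    have := Module.Finite.iff_fg.2 (h3.map N.mkQ)
    exact Module.Finite.iff_fg.1 (Submodule.finiteDimensional_of_le h2)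
  -- the annihilator of the right `Γ`-module `V / N`
  let J : Ideal Γ :=
    { carrier := {γ | ∀ v ∈ V.1, v * γ ∈ N}
      add_mem' := fun {x y} hx hy v hv => by
        rw [Subalgebra.coe_add, mul_add]
        exact add_mem (hx v hv) (hy v hv)
      zero_mem' := fun v _ => by simp
      smul_mem' := fun c x hx v hv => by
        rw [smul_eq_mul, Subalgebra.coe_mul, ← mul_assoc]
        exact hx _ (V.right_mem hv c.2) }
  let φ : Γ →ₗ[k] (S → Q) :=
    { toFun := fun γ s => ⟨N.mkQ (s * γ), _, V.right_mem (hSV _ s.2) γ.2, rfl⟩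
      map_add' := fun x y => by
        ext s
        simp [mul_add]
      map_smul' := fun c x => by
        ext s
        simp }
  have hker : (J.restrictScalars k) = LinearMap.ker φ := by
    ext γ
    rw [LinearMap.mem_ker, Submodule.restrictScalars_mem]
    constructor
    · intro h
      ext s
      exact (Submodule.Quotient.mk_eq_zero N).2 (h s (hSV _ s.2))
    · intro h v hv
      rw [hS] at hv
      have hs : ∀ s ∈ Submodule.span k (S : Set U), s * γ ∈ N := fun s hs => by
        induction hs using Submodule.span_induction with
        | mem x hx =>
          have := congrArg Subtype.val (congrFun h ⟨x, hx⟩)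
          exact (Submodule.Quotient.mk_eq_zero N).1 this
        | zero => simp
        | add x y _ _ hx hy => rw [add_mul]; exact add_mem hx hy
        | smul c x _ hx => rw [smul_mul_assoc]; exact Submodule.smul_mem _ c hx
      induction hv using Submodule.mul_induction_on' with
      | mem_mul_mem g hg s hs' =>
        rw [mul_assoc]
        have h1 := Submodule.mul_mem_mul (show g ∈ Γ.toSubmodule from hg) (hs s hs')
        rw [← mul_assoc] at h1
        have h2 : Γ.toSubmodule * idealSub (n ^ a) ≤ idealSub (k := k) (n ^ a) := by
          refine Submodule.mul_le.2 ?_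
          rintro g hg _ ⟨i, hi, rfl⟩
          exact mem_idealSub (Ideal.mul_mem_left _ (⟨g, hg⟩ : Γ) hi)
        have h3 : Γ.toSubmodule * idealSub (n ^ a) * V.1 ≤ N := mul_le_mul' h2 le_rfl
        exact h3 h1
      | add x _ y _ hx hy => rw [add_mul]; exact add_mem hx hy
  have : Module.Finite k Q := Module.Finite.iff_fg.2 hQ
  have hfin : Module.Finite k (Γ ⧸ J.restrictScalars k) := by
    have e := (Submodule.quotEquivOfEq _ _ hker).trans φ.quotKerEquivRange
    exact Module.Finite.equiv e.symm
  have hfin' : Module.Finite k (Γ ⧸ J) := hfin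
  have : IsArtinianRing (Γ ⧸ J) := IsArtinianRing.of_finite k (Γ ⧸ J)
  -- a power of the image of `p` is generated by an idempotent
  set P := p.map (Ideal.Quotient.mk J)
  obtain ⟨c, hc⟩ := IsArtinian.monotone_stabilizes
    (⟨fun i => OrderDual.toDual (P ^ i), fun i j h => Ideal.pow_le_pow_right h⟩ :
      ℕ →o (Ideal (Γ ⧸ J))ᵒᵈ)
  have hc' : ∀ i, c ≤ i → P ^ c = P ^ i := fun i hi => hc i hi
  have hid : IsIdempotentElem (P ^ (c + 1)) := by
    refine (pow_add P (c + 1) (c + 1)).symm.trans ?_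
    rw [← hc' (c + 1) (by omega), ← hc' (c + 1 + (c + 1)) (by omega)]
  obtain ⟨e, he, hPe⟩ := (Ideal.isIdempotentElem_iff_of_fg _ (IsNoetherian.noetherian _)).1 hid
  have heP : e ∈ (p ^ (c + 1)).map (Ideal.Quotient.mk J) := by
    rw [Ideal.map_pow, hPe]
    exact Ideal.mem_span_singleton_self e
  obtain ⟨δ, hδ, hδe⟩ := (Ideal.mem_map_iff_of_surjective _ Ideal.Quotient.mk_surjective).1 heP
  refine ⟨c + 1, 1 - δ, by omega, by simpa using hδ, fun v hv x hx => ?_⟩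
  have hmem : (1 - δ) * x ∈ J := by
    rw [← Ideal.Quotient.eq_zero_iff_mem, map_mul, map_sub, map_one, hδe]
    have hx' : Ideal.Quotient.mk J x ∈ P ^ (c + 1) := by
      rw [← Ideal.map_pow]
      exact Ideal.mem_map_of_mem _ hx
    rw [hPe] at hx'
    obtain ⟨y, hy⟩ := Ideal.mem_span_singleton'.1 hx'
    rw [← hy, mul_comm y e, ← mul_assoc, sub_mul, one_mul, he.eq, sub_self, zero_mul]
  have := hmem v hv
  rwa [Subalgebra.coe_mul, ← mul_assoc] at this

theorem IsCut.raise {a c : ℕ} {γ : Γ} (h : IsCut n p V a c γ) (d : ℕ) :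
    ∃ δ : Γ, ∀ e, c ≤ e → e ≤ c * d → IsCut n p V a e (γ * δ) := by
  obtain ⟨δ, hδ⟩ : γ ∣ 1 - (1 - γ) ^ d := by
    have := sub_dvd_pow_sub_pow 1 (1 - γ) d
    simpa using this
  refine ⟨δ, fun e hce hed => ⟨h.pos.trans hce, ?_, fun v hv x hx => ?_⟩⟩
  · rw [← hδ, sub_sub_cancel]
    have := Ideal.pow_mem_pow h.one_sub d
    rw [← pow_mul] at this
    exact Ideal.pow_le_pow_right hed this
  · have h1 := idealSub_mul_right V (n ^ a) (h.mem v hv x (Ideal.pow_le_pow_right hce hx)) δ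
    have h2 : v * γ * x * δ = v * ((γ * δ : Γ) : U) * x := by
      have : (x : U) * δ = δ * x := congrArg Subtype.val (mul_comm x δ)
      rw [mul_assoc _ (x : U), this, Subalgebra.coe_mul, ← mul_assoc, ← mul_assoc]
    rwa [h2] at h1

theorem exists_isCut₂ [Algebra.FiniteType k Γ] [IsHarishChandra Γ] (n n' p : Ideal Γ)
    [n.IsMaximal] [n'.IsMaximal] (V V' : FGBimod Γ) (a a' : ℕ) :
    ∃ c γ, IsCut n p V a c γ ∧ IsCut n' p V' a' c γ := by
  obtain ⟨c, γ, h⟩ := exists_isCut n p V a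
  obtain ⟨c', γ', h'⟩ := exists_isCut n' p V' a'
  have hc := h.pos
  have hc' := h'.pos
  obtain ⟨δ, hδ⟩ := h.raise (c + c')
  obtain ⟨δ', hδ'⟩ := h'.raise (c + c')
  have h1 := hδ (c + c') (by omega) (by nlinarith)
  have h1' := hδ' (c + c') (by omega) (by nlinarith)
  generalize γ * δ = α at h1
  generalize γ' * δ' = β at h1'
  have hone : 1 - α * β ∈ p ^ (c + c') := by
    have : 1 - α * β = (1 - α) + α * (1 - β) := by ring
    rw [this]
    exact add_mem h1.one_sub (Ideal.mul_mem_left _ _ h1'.one_sub)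
  refine ⟨c + c', α * β, ⟨h1.pos, hone, fun v hv x hx => ?_⟩, ⟨h1.pos, hone, fun v hv x hx => ?_⟩⟩
  · have := h1.mem v hv (β * x) (Ideal.mul_mem_left _ _ hx)
    rwa [Subalgebra.coe_mul, ← mul_assoc, mul_assoc v, ← Subalgebra.coe_mul] at this
  · have := h1'.mem v hv (α * x) (Ideal.mul_mem_left _ _ hx)
    rwa [Subalgebra.coe_mul, ← mul_assoc, mul_assoc v, ← Subalgebra.coe_mul, mul_comm β α] at this

/-- Key fact: `v γ w` modulo `𝔫ᵃ T + T 𝔪ᵇ` does not depend on the choices. -/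
theorem cut_congr (hT : V.1 * W.1 ≤ T.1) {x : Completion n p V} {y : Completion p m W}
    {a b c c' : ℕ} {γ γ' : Γ} (h : IsCut n p V a c γ) (h' : IsCut n p V a c' γ') {v v' w w' : U}
    (hv : Rep x a c v) (hv' : Rep x a c' v') (hw : Rep y c b w) (hw' : Rep y c' b w') :
    v * γ * w - v' * γ' * w' ∈ filt n m T a b := by
  have hIT : idealSub (n ^ a) * V.1 * W.1 ≤ idealSub (n ^ a) * T.1 := by
    rw [mul_assoc]
    exact mul_le_mul' le_rfl hT
  have hTI : V.1 * (W.1 * idealSub (m ^ b)) ≤ T.1 * idealSub (m ^ b) := by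
    rw [← mul_assoc]
    exact mul_le_mul' hT le_rfl
  have comm : ∀ g g' : Γ, (g : U) * g' = g' * g := fun g g' => congrArg Subtype.val (mul_comm g g')
  -- dependence on the representatives
  have main : ∀ (c : ℕ) (γ : Γ), IsCut n p V a c γ → ∀ v v' w w', Rep x a c v → Rep x a c v' →
      Rep y c b w → Rep y c b w' → v * γ * w - v' * γ * w' ∈ filt n m T a b := by
    intro c γ h v v' w w' hv hv' hw hw'
    have e : v * γ * w - v' * γ * w' = (v - v') * γ * w + v' * γ * (w - w') := by noncomm_ring
    rw [e]
    refine add_mem ?_ ?_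
    · obtain ⟨r, hr, s, hs, hrs⟩ := Submodule.mem_sup.1 (hv.sub_mem hv')
      rw [← hrs, add_mul, add_mul]
      refine add_mem (Submodule.mem_sup_left (hIT (Submodule.mul_mem_mul
        (idealSub_mul_right V _ hr γ) hw.1))) (Submodule.mem_sup_left (hIT
          (Submodule.mul_mem_mul ?_ hw.1)))
      clear hrs
      induction hs using Submodule.mul_induction_on' with
      | mem_mul_mem v hv i hi =>
        obtain ⟨i, hi, rfl⟩ := hi
        change v * (i : U) * γ ∈ _
        rw [mul_assoc, comm, ← mul_assoc]
        exact h.mem v hv i hi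
      | add r _ s _ hr hs => rw [add_mul]; exact add_mem hr hs
    · obtain ⟨r, hr, s, hs, hrs⟩ := Submodule.mem_sup.1 (hw.sub_mem hw')
      rw [← hrs, mul_add]
      refine add_mem (Submodule.mem_sup_left (hIT ?_)) (Submodule.mem_sup_right (hTI
          (Submodule.mul_mem_mul (V.right_mem hv'.1 γ.2) hs)))
      clear hrs
      induction hr using Submodule.mul_induction_on' with
      | mem_mul_mem i hi w hw =>
        obtain ⟨i, hi, rfl⟩ := hi
        change v' * γ * ((i : U) * w) ∈ _
        rw [← mul_assoc]
        exact Submodule.mul_mem_mul (h.mem v' hv'.1 i hi) hw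
      | add r _ s _ hr hs => rw [mul_add]; exact add_mem hr hs
  -- `v γ (1 - γ') ∈ 𝔫ᵃ V` for any two cuts
  have key : ∀ (c c' : ℕ) (γ γ' : Γ), IsCut n p V a c γ → IsCut n p V a c' γ' →
      ∀ v ∈ V.1, v * γ * ((1 - γ' : Γ) : U) ∈ idealSub (n ^ a) * V.1 := by
    intro c c' γ γ' h h' v hv
    have hpow : ∀ i : ℕ, v * γ * ((1 - γ' : Γ) : U) - v * γ * (((1 - γ') ^ (i + 1) : Γ) : U) ∈
        idealSub (n ^ a) * V.1 := by
      intro i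
      induction i with
      | zero => simp
      | succ i ih =>
        have h1 : v * γ * (((1 - γ') ^ (i + 1) : Γ) : U) - v * γ * (((1 - γ') ^ (i + 2) : Γ) : U) ∈
            idealSub (n ^ a) * V.1 := by
          have hx : (1 - γ') ^ (i + 1) ∈ p ^ c' := by
            rw [pow_succ]
            exact Ideal.mul_mem_left _ _ h'.one_sub
          have h2 := h'.mem (v * γ) (V.right_mem hv γ.2) _ hx
          have e : (1 - γ') ^ (i + 1) - (1 - γ') ^ (i + 2) = γ' * (1 - γ') ^ (i + 1) := by ring
          rw [← mul_sub, ← Subalgebra.coe_sub, e, Subalgebra.coe_mul, ← mul_assoc]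
          exact h2
        have := add_mem ih h1
        rwa [sub_add_sub_cancel] at this
    have h3 : (1 - γ') ^ (c + 1) ∈ p ^ c := by
      have h4 := Ideal.pow_mem_pow h'.one_sub (c + 1)
      rw [← pow_mul] at h4
      have := h'.pos
      exact Ideal.pow_le_pow_right (by nlinarith) h4
    have := add_mem (hpow c) (h.mem v hv _ h3)
    rwa [sub_add_cancel] at this
  obtain ⟨v₀, hv₀⟩ := exists_rep x a (max c c')
  obtain ⟨w₀, hw₀⟩ := exists_rep y (max c c') b
  have hvc := hv₀.mono le_rfl (le_max_left c c')
  have hvc' := hv₀.mono le_rfl (le_max_right c c')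
  have hwc := hw₀.mono (le_max_left c c') le_rfl
  have hwc' := hw₀.mono (le_max_right c c') le_rfl
  have e1 := main c γ h v v₀ w w₀ hv hvc hw hwc
  have e2 := main c' γ' h' v₀ v' w₀ w' hvc' hv' hwc' hw'
  have e3 : v₀ * γ * w₀ - v₀ * γ' * w₀ ∈ filt n m T a b := by
    have e : v₀ * γ * w₀ - v₀ * γ' * w₀ =
        (v₀ * γ * ((1 - γ' : Γ) : U) - v₀ * γ' * ((1 - γ : Γ) : U)) * w₀ := by
      simp only [Subalgebra.coe_sub, Subalgebra.coe_one, mul_sub, mul_one, mul_assoc, comm γ γ']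
      noncomm_ring
    rw [e]
    exact Submodule.mem_sup_left (hIT (Submodule.mul_mem_mul
      (sub_mem (key c c' γ γ' h h' v₀ hv₀.1) (key c' c γ' γ h' h v₀ hv₀.1)) hw₀.1))
  have := add_mem (add_mem e1 e3) e2
  rwa [sub_add_sub_cancel, sub_add_sub_cancel] at this

variable [Algebra.FiniteType k Γ] [IsHarishChandra Γ]

section Comp

variable [n.IsMaximal]

/-- The product `lim V/(𝔫ᵃV + V𝔭ᶜ) × lim W/(𝔭ᶜW + W𝔪ᵇ) ⟶ lim T/(𝔫ᵃT + T𝔪ᵇ)` for `VW ⊆ T`: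
its component at `(a, b)` is the class of `v γ w`, where `γ ∈ Γ` acts on `V / 𝔫ᵃ V` as the
projection onto the `𝔭`-primary component, `c` is large, and `v`, `w` represent the components of
`x`, `y` at `(a, c)` and `(c, b)`. -/
noncomputable def compFun (hT : V.1 * W.1 ≤ T.1) (x : Completion n p V) (y : Completion p m W) :
    Completion n m T :=
  ⟨fun a b => filtMk n m T a b
      ⟨(exists_rep x a (exists_isCut n p V a).choose).choose *
          ((exists_isCut n p V a).choose_spec.choose : Γ) *
          (exists_rep y (exists_isCut n p V a).choose b).choose,
        mul_cut_mem hT (exists_rep x a _).choose_spec.1 _ (exists_rep y _ b).choose_spec.1⟩, by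
    intro a a' b b' ha hb
    refine (filtMk_eq_iff n m T a b _ _).2 ?_
    exact cut_congr hT ((exists_isCut n p V a').choose_spec.choose_spec.mono ha)
      (exists_isCut n p V a).choose_spec.choose_spec
      ((exists_rep x a' _).choose_spec.mono ha le_rfl) (exists_rep x a _).choose_spec
      ((exists_rep y _ b').choose_spec.mono le_rfl hb) (exists_rep y _ b).choose_spec⟩

theorem Rep.comp (hT : V.1 * W.1 ≤ T.1) {x : Completion n p V} {y : Completion p m W}
    {a b c : ℕ} {γ : Γ} (h : IsCut n p V a c γ) {v w : U} (hv : Rep x a c v) (hw : Rep y c b w) :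
    Rep (compFun hT x y) a b (v * γ * w) :=
  Rep.of_sub_mem (v := (exists_rep x a (exists_isCut n p V a).choose).choose *
          ((exists_isCut n p V a).choose_spec.choose : Γ) *
          (exists_rep y (exists_isCut n p V a).choose b).choose)
    ⟨_, rfl⟩ (mul_cut_mem hT hv.1 γ hw.1)
    (cut_congr hT (exists_isCut n p V a).choose_spec.choose_spec h (exists_rep x a _).choose_spec
      hv (exists_rep y _ b).choose_spec hw)

/-- The product as a bilinear map. -/
noncomputable def compLin (hT : V.1 * W.1 ≤ T.1) :
    Completion n p V →ₗ[k] Completion p m W →ₗ[k] Completion n m T :=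
  LinearMap.mk₂ k (compFun hT)
    (fun x x' y => ext_rep fun a b => by
      obtain ⟨c, γ, h⟩ := exists_isCut n p V a
      obtain ⟨v, hv⟩ := exists_rep x a c
      obtain ⟨v', hv'⟩ := exists_rep x' a c
      obtain ⟨w, hw⟩ := exists_rep y c b
      refine ⟨_, Rep.comp hT h (hv.add hv') hw, ?_⟩
      rw [add_mul, add_mul]
      exact (Rep.comp hT h hv hw).add (Rep.comp hT h hv' hw))
    (fun r x y => ext_rep fun a b => by
      obtain ⟨c, γ, h⟩ := exists_isCut n p V a
      obtain ⟨v, hv⟩ := exists_rep x a c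
      obtain ⟨w, hw⟩ := exists_rep y c b
      refine ⟨_, Rep.comp hT h (hv.smul r) hw, ?_⟩
      rw [smul_mul_assoc, smul_mul_assoc]
      exact (Rep.comp hT h hv hw).smul r)
    (fun x y y' => ext_rep fun a b => by
      obtain ⟨c, γ, h⟩ := exists_isCut n p V a
      obtain ⟨v, hv⟩ := exists_rep x a c
      obtain ⟨w, hw⟩ := exists_rep y c b
      obtain ⟨w', hw'⟩ := exists_rep y' c b
      refine ⟨_, Rep.comp hT h hv (hw.add hw'), ?_⟩
      rw [mul_add]
      exact (Rep.comp hT h hv hw).add (Rep.comp hT h hv hw'))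
    (fun r x y => ext_rep fun a b => by
      obtain ⟨c, γ, h⟩ := exists_isCut n p V a
      obtain ⟨v, hv⟩ := exists_rep x a c
      obtain ⟨w, hw⟩ := exists_rep y c b
      refine ⟨_, Rep.comp hT h hv (hw.smul r), ?_⟩
      rw [mul_smul_comm]
      exact (Rep.comp hT h hv hw).smul r)

end Comp

end Completion

namespace FinitaryCompletion

open Completion

variable {n m p q : Ideal Γ}

theorem of_eq_of_rep {V W : FGBimod Γ} (T : FGBimod Γ) (hV : V ≤ T) (hW : W ≤ T)
    {x : Completion n m V} {y : Completion n m W} (h : ∀ a b, ∃ v, Rep x a b v ∧ Rep y a b v) :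
    of n m V x = of n m W y := by
  rw [← of_trans n m hV, ← of_trans n m hW]
  congr 1
  refine ext_rep fun a b => ?_
  obtain ⟨v, h1, h2⟩ := h a b
  exact ⟨v, h1.trans hV, h2.trans hW⟩

variable [Algebra.FiniteType k Γ] [IsHarishChandra Γ] [n.IsMaximal]

/-- The product of finitary completions, with `V` fixed. -/
noncomputable def compAux (V : FGBimod Γ) :
    FinitaryCompletion p m →ₗ[k] Completion n p V →ₗ[k] FinitaryCompletion n m :=
  lift
    (fun W => ((compLin (le_refl (V.mul W).1)).compr₂ (of n m (V.mul W))).flip)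
    fun W W' h y => by
      refine LinearMap.ext fun x => ?_
      rw [LinearMap.flip_apply, LinearMap.flip_apply, LinearMap.compr₂_apply,
        LinearMap.compr₂_apply]
      refine of_eq_of_rep (V.mul W') le_rfl (FGBimod.mul_mono le_rfl h) fun a b => ?_
      obtain ⟨c, γ, hc⟩ := exists_isCut n p V a
      obtain ⟨v, hv⟩ := exists_rep x a c
      obtain ⟨w, hw⟩ := exists_rep y c b
      exact ⟨_, Rep.comp le_rfl hc hv (hw.trans h), Rep.comp le_rfl hc hv hw⟩

/-- The composition `𝒜(𝔭, 𝔫) × 𝒜(𝔪, 𝔭) ⟶ 𝒜(𝔪, 𝔫)`: the direct limit of the products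
for `V`, `W` and `T = VW`. -/
noncomputable def comp :
    FinitaryCompletion n p →ₗ[k] FinitaryCompletion p m →ₗ[k] FinitaryCompletion n m :=
  lift (fun V => (compAux V).flip)
    fun V V' h x => by
      refine LinearMap.ext fun y => ?_
      obtain ⟨W, y, rfl⟩ := exists_of y
      rw [LinearMap.flip_apply, LinearMap.flip_apply, compAux, compAux, lift_of, lift_of,
        LinearMap.flip_apply, LinearMap.flip_apply, LinearMap.compr₂_apply, LinearMap.compr₂_apply]
      refine of_eq_of_rep (V'.mul W) le_rfl (FGBimod.mul_mono h le_rfl) fun a b => ?_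
      obtain ⟨c, γ, hc, hc'⟩ := exists_isCut₂ n n p V V' a a
      obtain ⟨v, hv⟩ := exists_rep x a c
      obtain ⟨w, hw⟩ := exists_rep y c b
      exact ⟨_, Rep.comp le_rfl hc' (hv.trans h) hw, Rep.comp le_rfl hc hv hw⟩

theorem comp_of (V W : FGBimod Γ) (x : Completion n p V) (y : Completion p m W) :
    comp (of n p V x) (of p m W y) = of n m (V.mul W) (compLin le_rfl x y) := by
  rw [comp, lift_of, LinearMap.flip_apply, compAux, lift_of, LinearMap.flip_apply,
    LinearMap.compr₂_apply]

theorem comp_assoc [p.IsMaximal] (x : FinitaryCompletion n p) (y : FinitaryCompletion p q)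
    (z : FinitaryCompletion q m) : comp (comp x y) z = comp x (comp y z) := by
  obtain ⟨V, x, rfl⟩ := exists_of x
  obtain ⟨W, y, rfl⟩ := exists_of y
  obtain ⟨Z, z, rfl⟩ := exists_of z
  rw [comp_of, comp_of, comp_of, comp_of]
  refine of_eq_of_rep ((V.mul W).mul Z) le_rfl (mul_assoc V.1 W.1 Z.1).ge fun a b => ?_
  obtain ⟨e, γ, he⟩ := exists_isCut n p V a
  obtain ⟨c, δ, hc, hc'⟩ := exists_isCut₂ n p q (V.mul W) W a e
  obtain ⟨v, hv⟩ := exists_rep x a e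
  obtain ⟨w, hw⟩ := exists_rep y e c
  obtain ⟨t, ht⟩ := exists_rep z c b
  refine ⟨_, Rep.comp le_rfl hc (Rep.comp le_rfl he hv hw) ht, ?_⟩
  have e : v * γ * w * δ * t = v * γ * (w * δ * t) := by simp only [mul_assoc]
  rw [e]
  exact Rep.comp le_rfl he hv (Rep.comp le_rfl hc' hw ht)

theorem one_comp (y : FinitaryCompletion n m) : comp (image n n 1) y = y := by
  obtain ⟨W, y, rfl⟩ := exists_of y
  rw [image, comp_of]
  obtain ⟨T, h1, h2⟩ := exists_ge_ge ((FGBimod.gen Γ 1).mul W) W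
  refine of_eq_of_rep T h1 h2 fun a b => ?_
  obtain ⟨c, γ, hc⟩ := exists_isCut n n (FGBimod.gen Γ 1) a
  obtain ⟨δ, hδ⟩ := hc.raise (a + 1)
  have := hc.pos
  have he := hδ (c * (a + 1)) (by nlinarith) le_rfl
  have hae : a ≤ c * (a + 1) := by nlinarith
  obtain ⟨w, hw⟩ := exists_rep y (c * (a + 1)) b
  refine ⟨_, Rep.comp le_rfl he (v := 1) ⟨FGBimod.mem_gen 1, rfl⟩ hw, ?_⟩
  have hw' := hw.mono hae le_rfl
  rw [one_mul]
  refine hw'.of_sub_mem (W.left_mem (γ * δ).2 hw.1) (Submodule.mem_sup_left ?_)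
  have h3 := Submodule.mul_mem_mul
    (mem_idealSub (k := k) (Ideal.pow_le_pow_right hae he.one_sub)) hw.1
  rwa [Subalgebra.coe_sub, Subalgebra.coe_one, sub_mul, one_mul] at h3

theorem comp_one (x : FinitaryCompletion n p) : comp x (image p p 1) = x := by
  obtain ⟨V, x, rfl⟩ := exists_of x
  rw [image, comp_of]
  obtain ⟨T, h1, h2⟩ := exists_ge_ge (V.mul (FGBimod.gen Γ 1)) V
  refine of_eq_of_rep T h1 h2 fun a b => ?_
  obtain ⟨c, γ, hc⟩ := exists_isCut n p V a
  obtain ⟨δ, hδ⟩ := hc.raise (b + 1)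
  have := hc.pos
  have he := hδ (c * (b + 1)) (by nlinarith) le_rfl
  have hbe : b ≤ c * (b + 1) := by nlinarith
  obtain ⟨v, hv⟩ := exists_rep x a (c * (b + 1))
  refine ⟨_, Rep.comp le_rfl he (w := 1) hv ⟨FGBimod.mem_gen 1, rfl⟩, ?_⟩
  have hv' := hv.mono le_rfl hbe
  rw [mul_one]
  refine hv'.of_sub_mem (V.right_mem hv.1 (γ * δ).2) (Submodule.mem_sup_right ?_)
  have h3 := Submodule.mul_mem_mul hv.1
    (mem_idealSub (k := k) (Ideal.pow_le_pow_right hbe he.one_sub))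
  rwa [Subalgebra.coe_sub, Subalgebra.coe_one, mul_sub, mul_one] at h3

end FinitaryCompletion

/-! ### The category `𝒜` -/

variable (Γ) in
/-- The objects of the category `𝒜`: the maximal ideals of `Γ`. -/
def PierceCat : Type u := MaximalSpectrum Γ

namespace PierceCat

/-- The maximal ideal underlying an object. -/
def ideal (m : PierceCat Γ) : Ideal Γ := MaximalSpectrum.asIdeal m

instance (m : PierceCat Γ) : m.ideal.IsMaximal := MaximalSpectrum.isMaximal m

variable [Algebra.FiniteType k Γ] [IsHarishChandra Γ]

/-- The category `𝒜`, with `𝒜(𝔪, 𝔫)` the finitary completion of `U` at `(𝔫, 𝔪)`. -/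
noncomputable instance : Category.{u} (PierceCat Γ) where
  Hom m n := FinitaryCompletion n.ideal m.ideal
  id m := FinitaryCompletion.image m.ideal m.ideal 1
  comp f g := FinitaryCompletion.comp g f
  id_comp f := FinitaryCompletion.comp_one f
  comp_id f := FinitaryCompletion.one_comp f
  assoc f g h := (FinitaryCompletion.comp_assoc h g f).symm

noncomputable instance : Preadditive (PierceCat Γ) where
  homGroup m n := inferInstanceAs (AddCommGroup (FinitaryCompletion n.ideal m.ideal))
  add_comp P _ _ f f' g := LinearMap.map_add (FinitaryCompletion.comp (m := P.ideal) g) f f'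
  comp_add P Q R f g g' := LinearMap.map_add₂ (FinitaryCompletion.comp (n := R.ideal)
    (p := Q.ideal) (m := P.ideal)) g g' f

noncomputable instance : Linear k (PierceCat Γ) where
  homModule m n := inferInstanceAs (Module k (FinitaryCompletion n.ideal m.ideal))
  smul_comp P _ _ r f g := LinearMap.map_smul (FinitaryCompletion.comp (m := P.ideal) g) r f
  comp_smul P Q R f r g := LinearMap.map_smul₂ (FinitaryCompletion.comp (n := R.ideal)
    (p := Q.ideal) (m := P.ideal)) r g f

/-- The morphism spaces of `𝒜` carry the direct limit (over `V`) of the inverse limit topologies. -/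
noncomputable instance (m n : PierceCat Γ) : TopologicalSpace (m ⟶ n) :=
  inferInstanceAs (TopologicalSpace (FinitaryCompletion n.ideal m.ideal))

/-- The image of `u ∈ U` in `𝒜(𝔪, 𝔫)`. -/
noncomputable def image (m n : PierceCat Γ) (u : U) : m ⟶ n :=
  FinitaryCompletion.image n.ideal m.ideal u

/-- `(𝔪, 𝔫) ∈ X_u`: with `V = Γ u Γ`, the space `V / (𝔫 V + V 𝔪) = Γ/𝔫 ⊗ V ⊗ Γ/𝔪` is nonzero. -/
def Linked (u : U) (m n : PierceCat Γ) : Prop :=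
  Nontrivial (filtQuot n.ideal m.ideal (FGBimod.gen Γ u) 1 1)

variable (Γ) in
/-- The equivalence relation `Δ` on the maximal ideals of `Γ` generated by all `X_u`, `u ∈ U`. -/
def linkage : Setoid (PierceCat Γ) := Relation.EqvGen.setoid fun m n => ∃ u, Linked u m n

end PierceCat

end GelfandTsetlin

section GelfandTsetlin

variable {k : Type w} {U : Type u} [Field k] [Ring U] [Algebra k U] {Γ : Subalgebra k U}

/-! Fix `u` and put `V = Γ u Γ`. For a maximal ideal `𝔫`, let `J` be the annihilator of the right
`Γ`-module `V / 𝔫 V`. From `V J ⊆ 𝔫 V` one gets `V Jᵃ ⊆ 𝔫ᵃ V`. If `J ⊄ 𝔪`, then `Jᵃ` and `𝔪ᵇ` are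
comaximal, so `V = 𝔫ᵃ V + V 𝔪ᵇ` for all `a`, `b`, and the entry of `u` at `(𝔫, 𝔪)` vanishes. Because
`V / 𝔫 V` is finite dimensional, only finitely many maximal ideals contain `J`, so each row is
finite. The mirror argument with `V / V 𝔪` makes each column finite (`finite_rightAnn_le`,
`finite_leftAnn_le`).

Multiplicativity is a partition of unity. The elements `γ_𝔭` that cut out the `𝔭`-primary components
of `V / 𝔫ᵃ V` are orthogonal idempotents modulo its annihilator, and those with `𝔭 ⊇ J` sum to `1`
there (`one_sub_sum_mem_rightAnn`). Inserting this sum between `u` and `v` writes `u v` as the sum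
over `𝔭` of the products `u γ_𝔭 v` that define the composites (`FinitaryCompletion.image_mul`).

Density is the Chinese remainder theorem. A basic open set constrains finitely many entries. Their
prescribed values all come from the completion of one bimodule `V`, and near each of them it is
enough to match a class modulo `𝔫ᵇ V + V 𝔪ᵇ` for one common `b`. If `e_i ∈ Γ` is congruent to `1`
modulo `𝔪_iᵇ` and to `0` modulo the other `𝔪_lᵇ`, and `v_ij ∈ V` represents the `(i, j)` entry, then
`∑ e_i v_ij e_j` represents all the entries at once (`exists_sub_mem_filt`). -/

theorem FGBimod.gen_le {V : FGBimod Γ} {v : U} (hv : v ∈ V.1) : FGBimod.gen Γ v ≤ V := by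
  refine Submodule.mul_le.2 fun x hx g hg => V.right_mem ?_ hg
  refine (Submodule.mul_le (P := V.1)).2 (fun g hg w hw => V.left_mem hg ?_) hx
  exact (Submodule.span_singleton_le_iff_mem v V.1).2 hv hw

/-- Counterpart of `FGBimod.exists_left_fg`; it makes `V / V 𝔪` finite dimensional, on which the
finiteness of columns rests. -/
theorem FGBimod.exists_right_fg [IsHarishChandra Γ] (V : FGBimod Γ) :
    ∃ S : Finset U, V.1 = Submodule.span k S * Γ.toSubmodule := by
  classical
  obtain ⟨V, S, rfl⟩ := V
  induction S using Finset.induction with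
  | empty => exact ⟨∅, by simp⟩
  | insert u S _ ih =>
    obtain ⟨T, hT⟩ := ih
    obtain ⟨T', hT'⟩ := IsHarishChandra.right_fg (Γ := Γ) u
    refine ⟨T' ∪ T, ?_⟩
    simp only at hT ⊢
    rw [Finset.coe_insert, Submodule.span_insert, Submodule.mul_sup, Submodule.sup_mul, hT, hT',
      Finset.coe_union, Submodule.span_union, Submodule.sup_mul]

theorem idealSub_mul_left (V : FGBimod Γ) (I : Ideal Γ) {y : U} (hy : y ∈ V.1 * idealSub I)
    (g : Γ) : (g : U) * y ∈ V.1 * idealSub I := by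
  induction hy using Submodule.mul_induction_on' with
  | mem_mul_mem v hv i hi =>
    rw [← mul_assoc]
    exact Submodule.mul_mem_mul (V.left_mem g.2 hv) hi
  | add x _ y _ hx hy =>
    rw [mul_add]
    exact add_mem hx hy

/-! ### Annihilators of the one-sided quotients of a bimodule -/

/-- The annihilator of the right `Γ`-module `V / I V`. -/
def rightAnn (I : Ideal Γ) (V : FGBimod Γ) : Ideal Γ where
  carrier := {γ | ∀ v ∈ V.1, v * γ ∈ idealSub I * V.1}
  add_mem' {x y} hx hy v hv := by
    rw [Subalgebra.coe_add, mul_add]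
    exact add_mem (hx v hv) (hy v hv)
  zero_mem' v _ := by simp
  smul_mem' c x hx v hv := by
    rw [smul_eq_mul, Subalgebra.coe_mul, ← mul_assoc]
    exact hx _ (V.right_mem hv c.2)

/-- The annihilator of the left `Γ`-module `V / V I`. -/
def leftAnn (I : Ideal Γ) (V : FGBimod Γ) : Ideal Γ where
  carrier := {γ | ∀ v ∈ V.1, (γ : U) * v ∈ V.1 * idealSub I}
  add_mem' {x y} hx hy v hv := by
    rw [Subalgebra.coe_add, add_mul]
    exact add_mem (hx v hv) (hy v hv)
  zero_mem' v _ := by simp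
  smul_mem' c x hx v hv := by
    rw [smul_eq_mul, Subalgebra.coe_mul, mul_assoc]
    exact idealSub_mul_left V I (hx v hv) c

theorem mul_idealSub_rightAnn_le (I : Ideal Γ) (V : FGBimod Γ) :
    V.1 * idealSub (rightAnn I V) ≤ idealSub I * V.1 := by
  refine Submodule.mul_le.2 ?_
  rintro v hv _ ⟨γ, hγ, rfl⟩
  exact hγ v hv

theorem idealSub_leftAnn_mul_le (I : Ideal Γ) (V : FGBimod Γ) :
    idealSub (leftAnn I V) * V.1 ≤ V.1 * idealSub I := by
  refine Submodule.mul_le.2 ?_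
  rintro _ ⟨γ, hγ, rfl⟩ v hv
  exact hγ v hv

theorem one_mem_idealSub_one : (1 : U) ∈ idealSub (k := k) (1 : Ideal Γ) :=
  mem_idealSub (x := (1 : Γ)) (by rw [Ideal.one_eq_top]; exact Submodule.mem_top)

/-! ### Powers of the annihilators and vanishing of classes -/

variable [IsMulCommutative Γ]

theorem idealSub_mul_mem_right (V : FGBimod Γ) (I : Ideal Γ) {y : U} (hy : y ∈ V.1 * idealSub I)
    (g : Γ) : y * g ∈ V.1 * idealSub I := by
  induction hy using Submodule.mul_induction_on' with
  | mem_mul_mem v hv i hi =>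
    obtain ⟨i, hi, rfl⟩ := hi
    rw [mul_assoc]
    exact Submodule.mul_mem_mul hv (mem_idealSub (Ideal.mul_mem_right g _ hi))
  | add x _ y _ hx hy =>
    rw [add_mul]
    exact add_mem hx hy

theorem idealSub_mul (I J : Ideal Γ) : idealSub (k := k) I * idealSub J = idealSub (I * J) := by
  refine le_antisymm (Submodule.mul_le.2 ?_) ?_
  · rintro _ ⟨i, hi, rfl⟩ _ ⟨j, hj, rfl⟩
    exact mem_idealSub (Ideal.mul_mem_mul hi hj)
  · rintro _ ⟨x, hx, rfl⟩
    change x ∈ I * J at hx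
    induction hx using Submodule.mul_induction_on' with
    | mem_mul_mem i hi j hj => exact Submodule.mul_mem_mul (mem_idealSub hi) (mem_idealSub hj)
    | add x _ y _ hx hy => exact add_mem hx hy

/-- Each factor `rightAnn I V` pushed to the left through `V` becomes a factor `I`. This controls
all the quotients `V / Iᵃ V` through the single ideal `rightAnn I V`, independent of `a`. -/
theorem mul_idealSub_rightAnn_pow_le (I : Ideal Γ) (V : FGBimod Γ) (a : ℕ) :
    V.1 * idealSub (rightAnn I V ^ a) ≤ idealSub (I ^ a) * V.1 := by
  induction a with
  | zero =>
    refine Submodule.mul_le.2 ?_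
    rintro v hv _ ⟨γ, -, rfl⟩
    rw [pow_zero, ← one_mul (v * _)]
    exact Submodule.mul_mem_mul one_mem_idealSub_one
      (V.right_mem hv γ.2)
  | succ a ih =>
    rw [pow_succ, pow_succ, ← idealSub_mul, ← idealSub_mul, ← mul_assoc]
    refine (mul_le_mul' ih le_rfl).trans ?_
    rw [mul_assoc, mul_assoc]
    exact mul_le_mul' le_rfl (mul_idealSub_rightAnn_le I V)

theorem idealSub_leftAnn_pow_mul_le (I : Ideal Γ) (V : FGBimod Γ) (b : ℕ) :
    idealSub (leftAnn I V ^ b) * V.1 ≤ V.1 * idealSub (I ^ b) := by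
  induction b with
  | zero =>
    refine Submodule.mul_le.2 ?_
    rintro _ ⟨γ, -, rfl⟩ v hv
    rw [pow_zero, ← mul_one (_ * v)]
    exact Submodule.mul_mem_mul (V.left_mem γ.2 hv) one_mem_idealSub_one
  | succ b ih =>
    rw [pow_succ', pow_succ', ← idealSub_mul, ← idealSub_mul, mul_assoc]
    refine (mul_le_mul' le_rfl ih).trans ?_
    rw [← mul_assoc, ← mul_assoc]
    exact mul_le_mul' (idealSub_leftAnn_mul_le I V) le_rfl

theorem rightAnn_pow_le (I : Ideal Γ) (V : FGBimod Γ) (a : ℕ) :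
    rightAnn I V ^ a ≤ rightAnn (I ^ a) V := fun _ hγ _ hv =>
  mul_idealSub_rightAnn_pow_le I V a (Submodule.mul_mem_mul hv (mem_idealSub hγ))

/-- The maximal ideal `m` is comaximal with `rightAnn n V`, hence so are their powers. Multiply `v`
on the right by `1 = j + x`, with `j ∈ (rightAnn n V)ᵃ` and `x ∈ mᵇ`: the term `v j` falls into `nᵃ
V`, and `v x` lies in `V mᵇ`. -/
theorem mem_filt_of_not_rightAnn_le {n m : Ideal Γ} [m.IsMaximal] {V : FGBimod Γ}
    (h : ¬ rightAnn n V ≤ m) (a b : ℕ) {v : U} (hv : v ∈ V.1) : v ∈ filt n m V a b := by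
  have htop : rightAnn n V ^ a ⊔ m ^ b = ⊤ := by
    refine Ideal.pow_sup_pow_eq_top ?_
    exact ‹m.IsMaximal›.1.2 _ (right_lt_sup.2 h)
  obtain ⟨j, hj, x, hx, e⟩ := Submodule.mem_sup.1 ((Ideal.eq_top_iff_one _).1 htop)
  have e' : v = v * j + v * x := by
    rw [← mul_add, ← Subalgebra.coe_add, e, Subalgebra.coe_one, mul_one]
  rw [e']
  exact Submodule.add_mem_sup
    (mul_idealSub_rightAnn_pow_le n V a (Submodule.mul_mem_mul hv (mem_idealSub hj)))
    (Submodule.mul_mem_mul hv (mem_idealSub hx))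

theorem mem_filt_of_not_leftAnn_le {n m : Ideal Γ} [n.IsMaximal] {V : FGBimod Γ}
    (h : ¬ leftAnn m V ≤ n) (a b : ℕ) {v : U} (hv : v ∈ V.1) : v ∈ filt n m V a b := by
  have htop : n ^ a ⊔ leftAnn m V ^ b = ⊤ :=
    Ideal.pow_sup_pow_eq_top (‹n.IsMaximal›.1.2 _ (left_lt_sup.2 h))
  obtain ⟨x, hx, j, hj, e⟩ := Submodule.mem_sup.1 ((Ideal.eq_top_iff_one _).1 htop)
  have e' : v = x * v + j * v := by
    rw [← add_mul, ← Subalgebra.coe_add, e, Subalgebra.coe_one, one_mul]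
  rw [e']
  exact Submodule.add_mem_sup (Submodule.mul_mem_mul (mem_idealSub hx) hv)
    (idealSub_leftAnn_pow_mul_le m V b (Submodule.mul_mem_mul (mem_idealSub hj) hv))

variable (k) in
-- The maximal ideals containing `J` are pulled back from maximal ideals of `A / J`, which is
-- Artinian and so has only finitely many.
theorem finite_maximal_ge_of_finite {A : Type*} [CommRing A] [Algebra k A] (J : Ideal A)
    [Module.Finite k (A ⧸ J)] : {P : MaximalSpectrum A | J ≤ P.asIdeal}.Finite := by
  have : IsArtinianRing (A ⧸ J) := IsArtinianRing.of_finite k (A ⧸ J)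
  refine Set.Finite.of_finite_image (f := MaximalSpectrum.asIdeal) ?_
    (fun P _ Q _ h => MaximalSpectrum.ext h)
  refine ((IsArtinianRing.setOfPred_isMaximal_finite (A ⧸ J)).image
    (Ideal.comap (Ideal.Quotient.mk J))).subset ?_
  rintro _ ⟨P, hP, rfl⟩
  have hP' : (P.asIdeal.map (Ideal.Quotient.mk J)).comap (Ideal.Quotient.mk J) = P.asIdeal := by
    rw [Ideal.comap_map_of_surjective _ Ideal.Quotient.mk_surjective, sup_eq_left,
      ← RingHom.ker_eq_comap_bot, Ideal.mk_ker]
    exact hP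
  refine ⟨_, ?_, hP'⟩
  refine (Ideal.map_eq_top_or_isMaximal_of_surjective _ Ideal.Quotient.mk_surjective
    P.isMaximal).resolve_left fun h => P.isMaximal.ne_top ?_
  rw [← hP', h, Ideal.comap_top]

theorem finite_of_le_sup {M : Type*} [AddCommGroup M] [Module k M] {V N C : Submodule k M}
    (hC : C.FG) (h : V ≤ N ⊔ C) : Module.Finite k (V.map N.mkQ) := by
  have h2 : V.map N.mkQ ≤ C.map N.mkQ := by
    refine (Submodule.map_mono h).trans ?_
    rw [Submodule.map_sup, Submodule.mkQ_map_self, bot_sup_eq]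
  have := Module.Finite.iff_fg.2 (hC.map N.mkQ)
  exact Submodule.finiteDimensional_of_le h2

/-! ### Cuts as orthogonal idempotents modulo the annihilator -/

theorem Completion.IsCut.mul_mem_rightAnn {n p : Ideal Γ} {V : FGBimod Γ} {a c : ℕ} {γ : Γ}
    (h : Completion.IsCut n p V a c γ) {x : Γ} (hx : x ∈ p ^ c) :
    γ * x ∈ rightAnn (n ^ a) V := fun v hv => by
  rw [Subalgebra.coe_mul, ← mul_assoc]
  exact h.mem v hv x hx

theorem Completion.IsCut.notMem {n p : Ideal Γ} [p.IsMaximal] {V : FGBimod Γ} {a c : ℕ} {γ : Γ}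
    (h : Completion.IsCut n p V a c γ) : γ ∉ p := fun hγ =>
  ‹p.IsMaximal›.ne_top <| (Ideal.eq_top_iff_one _).2 <| by
    have := add_mem (Ideal.pow_le_self (by have := h.pos; omega) h.one_sub) hγ
    rwa [sub_add_cancel] at this

/-- Since `p ≠ q`, some `x ∈ pᶜ` lies outside the prime `q`, while `γ x` annihilates `V / nᵃ V` and
so belongs to `q`. -/
theorem Completion.IsCut.mem_of_ne {n p q : Ideal Γ} [p.IsMaximal] [q.IsMaximal] {V : FGBimod Γ}
    {a c : ℕ} {γ : Γ} (h : Completion.IsCut n p V a c γ) (hq : rightAnn (n ^ a) V ≤ q)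
    (hpq : p ≠ q) : γ ∈ q := by
  obtain ⟨x, hx, hxq⟩ := SetLike.not_le_iff_exists.1 fun hle : p ^ c ≤ q =>
    hpq (Ideal.IsMaximal.eq_of_le ‹_› (Ideal.IsPrime.ne_top')
      (Ideal.IsPrime.le_of_pow_le hle))
  exact (Ideal.IsPrime.mem_or_mem inferInstance (hq (h.mul_mem_rightAnn hx))).resolve_right hxq

/-- Orthogonality of distinct primary components: write `1 = x + y` with `x ∈ pᶜ`, `y ∈ qᵈ`; then
`γ` kills `x` and `δ` kills `y` modulo the annihilator. -/
theorem Completion.IsCut.mul_mem_rightAnn_of_ne {n p q : Ideal Γ} [p.IsMaximal] [q.IsMaximal]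
    {V : FGBimod Γ} {a c d : ℕ} {γ δ : Γ} (h : Completion.IsCut n p V a c γ)
    (h' : Completion.IsCut n q V a d δ) (hpq : p ≠ q) : γ * δ ∈ rightAnn (n ^ a) V := by
  have htop : p ^ c ⊔ q ^ d = ⊤ :=
    Ideal.pow_sup_pow_eq_top (Ideal.IsMaximal.coprime_of_ne ‹_› ‹_› hpq)
  obtain ⟨x, hx, y, hy, e⟩ := Submodule.mem_sup.1 ((Ideal.eq_top_iff_one _).1 htop)
  have e' : γ * δ = δ * (γ * x) + γ * (δ * y) := by linear_combination -(γ * δ) * e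
  rw [e']
  exact add_mem (Ideal.mul_mem_left _ _ (h.mul_mem_rightAnn hx))
    (Ideal.mul_mem_left _ _ (h'.mul_mem_rightAnn hy))

/-- The partition of unity behind multiplicativity. It is checked locally: the elements multiplying
`ε = 1 - ∑ γ p` into the annihilator form an ideal `K`, which is shown to lie in no maximal ideal.
The set `s` depends on `rightAnn n V` only, so it serves for every `a`. -/
theorem one_sub_sum_mem_rightAnn (n : Ideal Γ) (V : FGBimod Γ) (a : ℕ)
    (s : Finset (PierceCat Γ)) (hs : ∀ p : PierceCat Γ, rightAnn n V ≤ p.ideal → p ∈ s)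
    {c : PierceCat Γ → ℕ} {γ : PierceCat Γ → Γ}
    (h : ∀ p, Completion.IsCut n p.ideal V a (c p) (γ p)) :
    1 - ∑ p ∈ s, γ p ∈ rightAnn (n ^ a) V := by
  classical
  set ε := 1 - ∑ p ∈ s, γ p with hε
  let K : Ideal Γ := (rightAnn (n ^ a) V).colon {ε}
  suffices hK : K = ⊤ by
    have := Submodule.mem_colon_singleton.1 ((Ideal.eq_top_iff_one K).1 hK)
    rwa [one_smul] at this
  by_contra hne
  obtain ⟨M, hM, hle⟩ := Ideal.exists_le_maximal _ hne
  let p : PierceCat Γ := ⟨M, hM⟩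
  -- `K` contains `rightAnn (n ^ a) V`, hence `(rightAnn n V) ^ a`; as `M` is prime, it contains
  -- `rightAnn n V`.
  have hp : p ∈ s := hs p <| Ideal.IsPrime.le_of_pow_le (n := a) <|
    (rightAnn_pow_le n V a).trans <| le_trans (fun x hx =>
      Submodule.mem_colon_singleton.2 (Ideal.mul_mem_right _ _ hx)) hle
  -- It remains to see `γ p ∈ K`. In `γ p * ε` the term `γ p * (1 - γ p)` dies because `1 - γ p ∈ p
  -- ^ c p`, and the terms `γ p * γ q` die by orthogonality.
  refine (h p).notMem (hle (Submodule.mem_colon_singleton.2 ?_))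
  rw [smul_eq_mul, hε, ← Finset.add_sum_erase s γ hp, ← sub_sub, mul_sub, Finset.mul_sum]
  refine sub_mem ((h p).mul_mem_rightAnn (h p).one_sub) (sum_mem fun q hq => ?_)
  exact (h p).mul_mem_rightAnn_of_ne (h q) fun e =>
    (Finset.mem_erase.1 hq).1 (MaximalSpectrum.ext e).symm

/-! ### Finiteness of rows and columns -/

section

variable [Algebra.FiniteType k Γ] [IsHarishChandra Γ]

/-- Right generators `S` of `V` determine the left action on `V / V m`, so `Γ / leftAnn m V` embeds
into the maps from `S` to this finite-dimensional space. -/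
theorem finite_quotient_leftAnn (m : Ideal Γ) [m.IsMaximal] (V : FGBimod Γ) :
    Module.Finite k (Γ ⧸ leftAnn m V) := by
  obtain ⟨S, hS⟩ := V.exists_right_fg
  obtain ⟨C, hC, hGC⟩ := Completion.exists_fg_sup_eq_top (k := k) m 1
  rw [pow_one] at hGC
  set N : Submodule k U := V.1 * idealSub m
  have hSV : ∀ s ∈ S, s ∈ V.1 := fun s hs => by
    rw [hS, ← mul_one s]
    exact Submodule.mul_mem_mul (Submodule.subset_span hs) Γ.one_mem
  -- Here `C` is a finite-dimensional complement, not necessarily direct, of `m` in `Γ`; so `V` is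
  -- spanned by finitely many products modulo `V m`.
  have h1 : V.1 ≤ N ⊔ Submodule.span k S * C := by
    conv_lhs => rw [hS]
    refine (mul_le_mul' le_rfl hGC).trans ?_
    rw [Submodule.mul_sup]
    exact sup_le_sup (mul_le_mul' (Submodule.span_le.2 hSV) le_rfl) le_rfl
  have := finite_of_le_sup ((Submodule.fg_span S.finite_toSet).mul hC) h1
  let φ : Γ →ₗ[k] (S → V.1.map N.mkQ) :=
    { toFun := fun γ s => ⟨N.mkQ (γ * s), _, V.left_mem γ.2 (hSV _ s.2), rfl⟩
      map_add' := fun x y => by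
        ext s
        simp [add_mul]
      map_smul' := fun c x => by
        ext s
        simp }
  have hker : ((leftAnn m V).restrictScalars k) = LinearMap.ker φ := by
    ext γ
    rw [LinearMap.mem_ker, Submodule.restrictScalars_mem]
    constructor
    · intro h
      ext s
      exact (Submodule.Quotient.mk_eq_zero N).2 (h s (hSV _ s.2))
    · intro h v hv
      rw [hS] at hv
      have hs : ∀ s ∈ Submodule.span k (S : Set U), γ * s ∈ N := fun s hs => by
        induction hs using Submodule.span_induction with
        | mem x hx =>
          have := congrArg Subtype.val (congrFun h ⟨x, hx⟩)
          exact (Submodule.Quotient.mk_eq_zero N).1 this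
        | zero => simp
        | add x y _ _ hx hy => rw [mul_add]; exact add_mem hx hy
        | smul c x _ hx => rw [mul_smul_comm]; exact Submodule.smul_mem _ c hx
      induction hv using Submodule.mul_induction_on' with
      | mem_mul_mem s hs' g hg =>
        rw [← mul_assoc]
        exact idealSub_mul_mem_right V m (hs s hs') ⟨g, hg⟩
      | add x _ y _ hx hy => rw [mul_add]; exact add_mem hx hy
  exact Module.Finite.equiv
    ((Submodule.quotEquivOfEq _ _ hker).trans φ.quotKerEquivRange).symm

theorem finite_leftAnn_le (m : Ideal Γ) [m.IsMaximal] (V : FGBimod Γ) :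
    {n : PierceCat Γ | leftAnn m V ≤ n.ideal}.Finite := by
  have := finite_quotient_leftAnn m V
  exact finite_maximal_ge_of_finite k (leftAnn m V)

/-- Each cut `γ p` lies outside `p`, so the cuts generate the unit ideal, and finitely many of them
already do. A maximal ideal `q ⊇ rightAnn n V` contains every `γ p` with `p ≠ q`, so `q` must be one
of the finitely many indices. -/
theorem finite_rightAnn_le (n : Ideal Γ) [n.IsMaximal] (V : FGBimod Γ) :
    {p : PierceCat Γ | rightAnn n V ≤ p.ideal}.Finite := by
  classical
  choose c γ h using fun p : PierceCat Γ => Completion.exists_isCut n p.ideal V 1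
  have htop : Ideal.span (Set.range γ) = ⊤ := by
    by_contra hne
    obtain ⟨M, hM, hle⟩ := Ideal.exists_le_maximal _ hne
    exact Completion.IsCut.notMem (p := M) (h ⟨M, hM⟩) (hle (Ideal.subset_span ⟨_, rfl⟩))
  obtain ⟨t, ht, htop⟩ := (Ideal.span_eq_top_iff_finite _).1 htop
  choose g hg using fun x : t => ht x.2
  refine (Finset.univ.image g).finite_toSet.subset fun q hq => ?_
  by_contra hqt
  refine q.isMaximal.ne_top (top_le_iff.1 (htop.symm.le.trans (Ideal.span_le.2 fun x hx => ?_)))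
  have hgx : γ (g ⟨x, hx⟩) = x := hg ⟨x, hx⟩
  refine hgx ▸ (h (g ⟨x, hx⟩)).mem_of_ne (q := q.ideal) (by rwa [pow_one]) fun e => hqt ?_
  rw [← show g ⟨x, hx⟩ = q from MaximalSpectrum.ext e]
  exact Finset.mem_coe.2 (Finset.mem_image_of_mem g (Finset.mem_univ _))

end

/-! ### Images of elements of `U` -/

namespace Completion

variable {n m : Ideal Γ} {V : FGBimod Γ}

theorem rep_const {v : U} (hv : v ∈ V.1) (a b : ℕ) : Rep (const n m v hv) a b v := ⟨hv, rfl⟩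

theorem rep_zero (a b : ℕ) : Rep (0 : Completion n m V) a b 0 :=
  ⟨zero_mem _, map_zero (filtMk n m V a b)⟩

theorem rep_sum {ι : Type*} (s : Finset ι) {x : ι → Completion n m V} {a b : ℕ} {v : ι → U}
    (h : ∀ i ∈ s, Rep (x i) a b (v i)) : Rep (∑ i ∈ s, x i) a b (∑ i ∈ s, v i) := by
  classical
  induction s using Finset.induction with
  | empty => exact rep_zero a b
  | insert i s hi ih =>
    rw [Finset.sum_insert hi, Finset.sum_insert hi]
    exact (h i (Finset.mem_insert_self i s)).add
      (ih fun j hj => h j (Finset.mem_insert_of_mem hj))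

theorem eq_of_rep_sub_mem {x y : Completion n m V} (h : ∀ a b, ∃ v w, Rep x a b v ∧ Rep y a b w ∧
    v - w ∈ filt n m V a b) : x = y :=
  ext_rep fun a b => by
    obtain ⟨v, w, hv, hw, hvw⟩ := h a b
    exact ⟨w, hv.of_sub_mem hw.1 hvw, hw⟩

theorem const_eq_zero {v : U} (hv : v ∈ V.1) (h : ∀ a b, v ∈ filt n m V a b) :
    const n m v hv = 0 :=
  eq_of_rep_sub_mem fun a b => ⟨v, 0, rep_const hv a b, rep_zero a b, by simpa using h a b⟩

end Completion

namespace FinitaryCompletion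

open Completion

/-- The image of `v` may be computed in any bimodule containing `v`. This lets elements with
different generated bimodules be compared inside a common one. -/
theorem of_const (n m : Ideal Γ) {V : FGBimod Γ} {v : U} (hv : v ∈ V.1) :
    of n m V (const n m v hv) = image n m v := by
  rw [image, ← of_trans n m (FGBimod.gen_le hv)]
  rfl

/-- The image of `U` in the finitary completion, as a linear map. -/
noncomputable def imageLin (n m : Ideal Γ) : U →ₗ[k] FinitaryCompletion n m where
  toFun := image n m
  map_add' u v := by
    obtain ⟨T, hu, hv⟩ := exists_ge_ge (FGBimod.gen Γ u) (FGBimod.gen Γ v)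
    have hu := hu (FGBimod.mem_gen u)
    have hv := hv (FGBimod.mem_gen v)
    rw [← of_const n m hu, ← of_const n m hv, ← of_const n m (add_mem hu hv), ← map_add]
    rfl
  map_smul' c u := by
    have hu := FGBimod.mem_gen (Γ := Γ) u
    rw [← of_const n m hu, ← of_const n m (Submodule.smul_mem _ c hu), RingHom.id_apply, ← map_smul]
    rfl

theorem image_eq_zero {n m : Ideal Γ} {u : U} (h : ∀ a b, u ∈ filt n m (FGBimod.gen Γ u) a b) :
    image n m u = 0 := by
  rw [image, const_eq_zero _ h, map_zero]

/-- Comaximality writes `1 = x + y` with `x ∈ nᵃ`, `y ∈ mᵇ`, so `1` has zero class in every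
quotient. -/
theorem image_one_of_ne {n m : Ideal Γ} [n.IsMaximal] [m.IsMaximal] (h : n ≠ m) :
    image n m (1 : U) = 0 := by
  suffices h' : ∀ V : FGBimod Γ, (1 : U) ∈ V.1 → ∀ a b, (1 : U) ∈ filt n m V a b from
    image_eq_zero (h' _ (FGBimod.mem_gen 1))
  intro V hV a b
  have htop : n ^ a ⊔ m ^ b = ⊤ :=
    Ideal.pow_sup_pow_eq_top (Ideal.IsMaximal.coprime_of_ne ‹_› ‹_› h)
  obtain ⟨x, hx, y, hy, e⟩ := Submodule.mem_sup.1 ((Ideal.eq_top_iff_one _).1 htop)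
  have h2 : (x : U) * 1 + 1 * y ∈ filt n m V a b :=
    Submodule.add_mem_sup (Submodule.mul_mem_mul (mem_idealSub hx) hV)
      (Submodule.mul_mem_mul hV (mem_idealSub hy))
  rwa [mul_one, one_mul, ← Subalgebra.coe_add, e, Subalgebra.coe_one] at h2

variable [Algebra.FiniteType k Γ] [IsHarishChandra Γ]

/-- At level `(a, b)` the two sides differ by `u (1 - ∑ γ p) v`. The partition of unity puts `u (1 -
∑ γ p)` into `nᵃ V`, where `V = Γ u Γ`, hence the difference into `nᵃ V W` with `W = Γ v Γ`. -/
theorem image_mul (n m : Ideal Γ) [n.IsMaximal] (u v : U) (s : Finset (PierceCat Γ))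
    (hs : ∀ p : PierceCat Γ, rightAnn n (FGBimod.gen Γ u) ≤ p.ideal → p ∈ s) :
    image n m (u * v) = ∑ p ∈ s, comp (image n p.ideal u) (image p.ideal m v) := by
  have hu := FGBimod.mem_gen (Γ := Γ) u
  have hv := FGBimod.mem_gen (Γ := Γ) v
  have huv : u * v ∈ ((FGBimod.gen Γ u).mul (FGBimod.gen Γ v)).1 := Submodule.mul_mem_mul hu hv
  rw [← of_const n m huv]
  simp only [image, comp_of]
  rw [← map_sum]
  congr 1
  refine eq_of_rep_sub_mem fun a b => ?_
  choose c γ h using fun p : PierceCat Γ => exists_isCut n p.ideal (FGBimod.gen Γ u) a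
  refine ⟨_, _, rep_const huv a b, rep_sum s fun p _ =>
    Rep.comp le_rfl (h p) (rep_const hu a (c p)) (rep_const hv (c p) b), ?_⟩
  have h1 := one_sub_sum_mem_rightAnn n _ a s hs h u hu
  rw [← Finset.sum_mul, ← Finset.mul_sum, ← sub_mul]
  rw [Subalgebra.coe_sub, Subalgebra.coe_one, mul_sub, mul_one, AddSubmonoidClass.coe_finsetSum]
    at h1
  refine Submodule.mem_sup_left ?_
  have h2 := Submodule.mul_mem_mul h1 hv
  rwa [mul_assoc] at h2

end FinitaryCompletion

/-! ### The matrix of an element of `U` -/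

namespace PierceCat

variable [Algebra.FiniteType k Γ] [IsHarishChandra Γ]

theorem image_eq_zero_of_not_rightAnn_le {n m : PierceCat Γ} {u : U}
    (h : ¬ rightAnn n.ideal (FGBimod.gen Γ u) ≤ m.ideal) : image m n u = 0 :=
  FinitaryCompletion.image_eq_zero fun a b =>
    mem_filt_of_not_rightAnn_le h a b (FGBimod.mem_gen u)

theorem image_eq_zero_of_not_leftAnn_le {n m : PierceCat Γ} {u : U}
    (h : ¬ leftAnn m.ideal (FGBimod.gen Γ u) ≤ n.ideal) : image m n u = 0 :=
  FinitaryCompletion.image_eq_zero fun a b =>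
    mem_filt_of_not_leftAnn_le h a b (FGBimod.mem_gen u)

variable (Γ) in
/-- The matrix with entries the images of `u`. -/
noncomputable def imageMatrix (u : U) : RCFMatrix k (fun m : PierceCat Γ => m) :=
  ⟨fun n m => image m n u,
    fun n => (finite_rightAnn_le n.ideal (FGBimod.gen Γ u)).subset fun _ hm => by
      by_contra h
      exact hm (image_eq_zero_of_not_rightAnn_le h),
    fun m => (finite_leftAnn_le m.ideal (FGBimod.gen Γ u)).subset fun _ hn => by
      by_contra h
      exact hn (image_eq_zero_of_not_leftAnn_le h)⟩

variable (Γ) in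
/-- The homomorphism sending `u` to the matrix of its images. -/
noncomputable def imageHom : U →ₐ[k] RCFMatrix k (fun m : PierceCat Γ => m) :=
  AlgHom.ofLinearMap
    { toFun := imageMatrix Γ
      map_add' := fun u v => RCFMatrix.ext' fun n m =>
        map_add (FinitaryCompletion.imageLin n.ideal m.ideal) u v
      map_smul' := fun c u => RCFMatrix.ext' fun n m =>
        map_smul (FinitaryCompletion.imageLin n.ideal m.ideal) c u }
    (RCFMatrix.ext' fun n m => by
      by_cases h : m = n
      · subst h
        exact (RCFMatrix.one_apply_same (k := k) (X := fun m : PierceCat Γ => m) m).symm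
      · rw [RCFMatrix.one_apply_ne h]
        exact FinitaryCompletion.image_one_of_ne fun e => h (MaximalSpectrum.ext e.symm))
    (fun u v => RCFMatrix.ext' fun n m => by
      have hfin := finite_rightAnn_le n.ideal (FGBimod.gen Γ u)
      have hs : ∀ p : PierceCat Γ, rightAnn n.ideal (FGBimod.gen Γ u) ≤ p.ideal →
          p ∈ hfin.toFinset := fun p hp => hfin.mem_toFinset.2 hp
      -- The matrix product sums over the nonzero entries of the row of `u`; these lie in the finite
      -- set of maximal ideals above the annihilator, and the additional terms are zero.
      refine Eq.trans ?_ (RCFMatrix.mulEntry_eq_sum (imageMatrix Γ u) (imageMatrix Γ v) n m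
        hfin.toFinset fun p hp => hs p ?_).symm
      · exact FinitaryCompletion.image_mul n.ideal m.ideal u v _ hs
      · by_contra h
        exact hp (image_eq_zero_of_not_rightAnn_le h))

end PierceCat

/-! ### Density -/

/-- The diagonal indices `(c, c)` are cofinal, so fixing one diagonal component fixes all earlier
ones, and these conditions form a directed neighbourhood basis. -/
theorem Completion.exists_forall_mem_of_isOpen {n m : Ideal Γ} {V : FGBimod Γ}
    {O : Set (Completion n m V)} (hO : IsOpen O) {x : Completion n m V} (hx : x ∈ O) :
    ∃ a, ∀ b, a ≤ b → ∀ y : Completion n m V, y.1 b b = x.1 b b → y ∈ O := by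
  let S : ℕ → Set (Completion n m V) := fun c => {y | y.1 c c = x.1 c c}
  have hS : ∀ a b c, a ≤ c → b ≤ c → ∀ y ∈ S c, y.1 a b = x.1 a b := fun a b c ha hb y hy => by
    rw [← y.2 a c b c ha hb, ← x.2 a c b c ha hb, show y.1 c c = x.1 c c from hy]
  have hle : ⨅ c, Filter.principal (S c) ≤ nhds x := by
    rw [nhds_iInf]
    refine le_iInf fun a => ?_
    rw [nhds_iInf]
    refine le_iInf fun b => ?_
    let _ : TopologicalSpace (filtQuot n m V a b) := ⊥
    have : DiscreteTopology (filtQuot n m V a b) := ⟨rfl⟩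
    rw [nhds_induced, nhds_discrete, Filter.comap_pure]
    exact iInf_le_of_le (max a b) (Filter.principal_mono.2
      (hS a b _ (le_max_left a b) (le_max_right a b)))
  have hdir : Directed (· ≥ ·) fun c => Filter.principal (S c) := fun c d =>
    ⟨max c d, Filter.principal_mono.2 (hS c c _ (le_max_left c d) (le_max_left c d)),
      Filter.principal_mono.2 (hS d d _ (le_max_right c d) (le_max_right c d))⟩
  obtain ⟨a, ha⟩ := (Filter.mem_iInf_of_directed hdir _).1 (hle (hO.mem_nhds hx))
  exact ⟨a, fun b hab y hy => Filter.mem_principal.1 ha (hS a a b hab hab y hy)⟩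

/-- Simultaneous approximation by the two-sided Chinese remainder theorem, with witness `∑ e i * v i
j * e j` for idempotents `e i` modulo the powers of the distinct maximal ideals. -/
theorem exists_sub_mem_filt {ι : Type*} [Fintype ι] {X : ι → PierceCat Γ} (hX : Function.Injective X)
    (V : FGBimod Γ) (a : ℕ) (v : ι → ι → U) (hv : ∀ i j, v i j ∈ V.1) :
    ∃ w ∈ V.1, ∀ i j, w - v i j ∈ filt (X i).ideal (X j).ideal V a a := by
  classical
  have hcop : Pairwise fun i j => IsCoprime ((X i).ideal ^ a) ((X j).ideal ^ a) :=
    fun i j hij => Ideal.isCoprime_iff_sup_eq.2 <| Ideal.pow_sup_pow_eq_top <|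
      Ideal.IsMaximal.coprime_of_ne inferInstance inferInstance fun e =>
        hij (hX (MaximalSpectrum.ext e))
  choose e he using fun i : ι => Ideal.exists_forall_sub_mem_ideal hcop (Pi.single i (1 : Γ))
  have he1 : ∀ i, e i - 1 ∈ (X i).ideal ^ a := fun i => by simpa using he i i
  have he0 : ∀ i j, j ≠ i → e j ∈ (X i).ideal ^ a := fun i j hj => by
    simpa [Pi.single_eq_of_ne hj.symm] using he j i
  have hy : ∀ i, ∑ j, v i j * e j ∈ V.1 := fun i =>
    sum_mem fun j _ => V.right_mem (hv i j) (e j).2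
  refine ⟨∑ i, e i * ∑ j, v i j * e j,
    sum_mem fun i _ => V.left_mem (e i).2 (hy i), fun i j => ?_⟩
  -- Left multiplication by the `e l` selects row `i` modulo `(X i) ^ a`; in `h2`, right
  -- multiplication selects column `j`.
  have h1 : ∑ i, (e i : U) * ∑ j, v i j * e j - ∑ j, v i j * e j ∈
      idealSub ((X i).ideal ^ a) * V.1 := by
    rw [← Finset.add_sum_erase Finset.univ _ (Finset.mem_univ i), add_sub_right_comm]
    refine add_mem ?_ (sum_mem fun l hl => Submodule.mul_mem_mul
      (mem_idealSub (he0 i l (Finset.ne_of_mem_erase hl))) (hy l))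
    have := Submodule.mul_mem_mul (mem_idealSub (k := k) (he1 i)) (hy i)
    rwa [Subalgebra.coe_sub, Subalgebra.coe_one, sub_mul, one_mul] at this
  have h2 : ∑ j, v i j * e j - v i j ∈ V.1 * idealSub ((X j).ideal ^ a) := by
    rw [← Finset.add_sum_erase Finset.univ _ (Finset.mem_univ j), add_sub_right_comm]
    refine add_mem ?_ (sum_mem fun l hl => Submodule.mul_mem_mul (hv i l)
      (mem_idealSub (he0 j l (Finset.ne_of_mem_erase hl))))
    have := Submodule.mul_mem_mul (hv i j) (mem_idealSub (k := k) (he1 j))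
    rwa [Subalgebra.coe_sub, Subalgebra.coe_one, mul_sub, mul_one] at this
  have := Submodule.add_mem_sup h1 h2
  rwa [sub_add_sub_cancel] at this

theorem FinitaryCompletion.isOpen_preimage_of (n m : Ideal Γ) (V : FGBimod Γ)
    {O : Set (FinitaryCompletion n m)} (hO : IsOpen O) : IsOpen (of n m V ⁻¹' O) :=
  isOpen_coinduced.1 (isOpen_iSup_iff.1 hO V)

variable [Algebra.FiniteType k Γ] [IsHarishChandra Γ]

/-- Directedness brings the finitely many entries into one bimodule `V` and to one level `b`, where
the Chinese remainder element is a common approximation. Since that element lies in `V` itself, only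
the open preimages in the completion of `V` matter. -/
theorem PierceCat.exists_image_mem {ι : Type*} {X : ι → PierceCat Γ} (hX : Function.Injective X)
    (s : Finset ι) (F : ∀ i j, X j ⟶ X i) (O : ∀ i j, Set (X j ⟶ X i))
    (hO : ∀ i ∈ s, ∀ j ∈ s, IsOpen (O i j)) (hF : ∀ i ∈ s, ∀ j ∈ s, F i j ∈ O i j) :
    ∃ u : U, ∀ i ∈ s, ∀ j ∈ s, image (X j) (X i) u ∈ O i j := by
  classical
  choose W y hy using fun i j => FinitaryCompletion.exists_of (F i j)
  obtain ⟨V, hV⟩ := Finset.exists_le ((s ×ˢ s).image fun p => W p.1 p.2)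
  have hx : ∀ i j, ∃ x : Completion (X i).ideal (X j).ideal V, i ∈ s → j ∈ s →
      FinitaryCompletion.of _ _ V x = F i j := fun i j => by
    by_cases h : i ∈ s ∧ j ∈ s
    · have hW : W i j ≤ V := hV _ (Finset.mem_image_of_mem (fun p : ι × ι => W p.1 p.2)
        (Finset.mk_mem_product h.1 h.2))
      exact ⟨Completion.trans _ _ _ _ hW (y i j), fun _ _ =>
        (FinitaryCompletion.of_trans _ _ hW (y i j)).trans (hy i j)⟩
    · exact ⟨0, fun hi hj => (h ⟨hi, hj⟩).elim⟩
  choose x hx using hx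
  have ha : ∀ i j, ∃ a, i ∈ s → j ∈ s → ∀ b, a ≤ b →
      ∀ z : Completion (X i).ideal (X j).ideal V, z.1 b b = (x i j).1 b b →
        FinitaryCompletion.of _ _ V z ∈ O i j := fun i j => by
    by_cases h : i ∈ s ∧ j ∈ s
    · obtain ⟨a, ha⟩ := Completion.exists_forall_mem_of_isOpen
        (FinitaryCompletion.isOpen_preimage_of _ _ V (hO i h.1 j h.2)) (x := x i j)
        (by rw [Set.mem_preimage, hx i j h.1 h.2]; exact hF i h.1 j h.2)
      exact ⟨a, fun _ _ => ha⟩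
    · exact ⟨0, fun hi hj => (h ⟨hi, hj⟩).elim⟩
  choose a ha using ha
  let b := (s ×ˢ s).sup fun p => a p.1 p.2
  choose v hv using fun i j => Completion.exists_rep (x i j) b b
  obtain ⟨w, hwV, hw⟩ := exists_sub_mem_filt (X := fun i : s => X i)
    (hX.comp Subtype.val_injective) V b (fun i j => v i j) fun i j => (hv i j).1
  refine ⟨w, fun i hi j hj => ?_⟩
  have hb : a i j ≤ b := Finset.le_sup (f := fun p : ι × ι => a p.1 p.2)
    (Finset.mk_mem_product hi hj)
  rw [image, ← FinitaryCompletion.of_const _ _ hwV]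
  -- `w` and `v i j` agree modulo the filtration at `(b, b)`, so the constant family of `w` has the
  -- same component there as `x i j`.
  refine ha i j hi hj b hb _ (Eq.trans ?_ (hv i j).2)
  exact (filtMk_eq_iff _ _ V b b _ _).2 (hw ⟨i, hi⟩ ⟨j, hj⟩)

theorem PierceCat.denseRange_block_imageHom (D : Set (PierceCat Γ)) :
    DenseRange fun u : U => RCFMatrix.block D (imageHom Γ u) := by
  classical
  intro F
  refine mem_closure_iff.2 fun O hO hFO => ?_
  obtain ⟨O', hO', rfl⟩ := isOpen_induced_iff.1 hO
  -- The product topology is unfolded twice: finitely many rows `I` are constrained, and then in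
  -- each row `i ∈ I` finitely many columns `J i`.
  obtain ⟨I, P, hP, hPO⟩ := isOpen_pi_iff.1 hO' F.1 hFO
  have hQ : ∀ i : D, ∃ (J : Finset D) (Q : ∀ j : D, Set ((j : PierceCat Γ) ⟶ (i : PierceCat Γ))),
      i ∈ I → (∀ j ∈ J, IsOpen (Q j) ∧ F.1 i j ∈ Q j) ∧ (J : Set D).pi Q ⊆ P i := fun i => by
    by_cases hi : i ∈ I
    · obtain ⟨J, Q, h⟩ := isOpen_pi_iff.1 (hP i hi).1 (F.1 i) (hP i hi).2
      exact ⟨J, Q, fun _ => h⟩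
    · exact ⟨∅, fun _ => ∅, fun h => (hi h).elim⟩
  choose J Q hQ using hQ
  -- One finite index set serves for both rows and columns; the entries of this square outside the
  -- constrained positions are left free by `Set.univ`.
  obtain ⟨u, hu⟩ := exists_image_mem (Subtype.val_injective (p := (· ∈ D))) (I ∪ I.biUnion J) F.1
    (fun i j => if i ∈ I ∧ j ∈ J i then Q i j else Set.univ)
    (fun i _ j _ => by
      split_ifs with h
      · exact ((hQ i h.1).1 j h.2).1
      · exact isOpen_univ)
    (fun i _ j _ => by
      split_ifs with h
      · exact ((hQ i h.1).1 j h.2).2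
      · exact Set.mem_univ _)
  refine ⟨_, hPO fun i hi => (hQ i hi).2 fun j hj => ?_, u, rfl⟩
  have := hu i (Finset.mem_union_left _ hi) j
    (Finset.mem_union_right _ (Finset.mem_biUnion.2 ⟨i, hi, hj⟩))
  rw [if_pos ⟨hi, hj⟩] at this
  exact this

end GelfandTsetlin

/-! ### The main theorem -/

theorem mainTheorem12 {k : Type w} {U : Type u} [Field k] [IsAlgClosed k] [CharZero k]
    [Ring U] [Algebra k U] (Γ : Subalgebra k U) [IsMulCommutative Γ] [Algebra.FiniteType k Γ]
    [IsHarishChandra Γ] :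
    ∃ i : U →ₐ[k] RCFMatrix k (fun m : PierceCat Γ => m),
      (∀ (u : U) (n m : PierceCat Γ), (i u).1 n m = PierceCat.image m n u) ∧
      ∀ D ∈ (PierceCat.linkage Γ).classes, DenseRange fun u : U => RCFMatrix.block D (i u) :=
  ⟨PierceCat.imageHom Γ, fun _ _ _ => rfl, fun D _ => PierceCat.denseRange_block_imageHom D⟩
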